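/- Let $k$ be an infinite field of characteristic $p>0$ and let $n\ge 1$. For $q=p^e$, $e\ge 0$, let $$W_q^n=k[x_1,y_1]\,\#\,k[x_2,y_2](q)\,\#\cdots\#\,k[x_n,y_n]((n-1)q)$$ be the $\mathbb Z$-graded twisted Segre product: $(W_q^n)_d=\bigotimes_{i=1}^n k[x_i,y_i]_{d+(i-1)q}$, where the tensor products are over $k$ and $k[x_i,y_i]$ is standard graded. It is a graded module over $T_n=k[x_1,y_1]\#\cdots\# k[x_n,y_n]$. Let $z_1,\dots,z_{n+1}$ be homogeneous elements of degree one in $T_n$ such that $T_n$ is a finite module over the subring $A_n=k[z_1,\dots,z_{n+1}]$ (for example, general linear forms). View $W_q^n$ as a graded $A_n$-module, let $\mathfrak m=(z_1,\dots,z_{n+1})$, and let $H^j_{\mathfrak m}(W_q^n)=\bigoplus_{d\in\mathbb Z}H^j_{\mathfrak m}(W_q^n)_d$ be the graded local cohomology. Then: (a) For every $q=p^e$ and every $2\le j\le n$, $H^j_{\mathfrak m}(W_q^n)$ sits in degrees $-(j-1)q\le d\le -(j-2)q-2$. (b) For every $q=p^e$, $H^{n+1}_{\mathfrak m}(W_q^n)$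 sits in degrees $d\le -(n-1)q-2$. (c) Fix an integer $r>0$. For every $2\le j\le n+1$, the space $H^j_{\mathfrak m}(W_q^n)_{-(j-2)q-r}$ is finite-dimensional over $k$, and its dimension is $o(q^n)$ as $q=p^e\to\infty$. For every fixed integer $t\ge 0$, the space $H^{n+1}_{\mathfrak m}(W_q^n)_{-(n+t)q-r}$ is finite-dimensional over $k$, and its dimension is $o(q^{n+1})$ as $q=p^e\to\infty$. (d) Consequently, for every fixed integer $r>0$ and every $0\le j\le n$, the space $H^j_{\mathfrak m}(W_q^n)_{-r \bmod q}:=\bigoplus_{i\in\mathbb Z}H^j_{\mathfrak m}(W_q^n)_{-r+iq}$ is finite-dimensional over $k$, and its dimension is $o(q^n)$ as $q=p^e\to\infty$. -/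

import Mathlib

noncomputable section

/-! ### Čech cohomology of a graded module

Here `A` is a commutative `k`-algebra, `z` is a finite family of elements of `A`, `M` is an
`A`-module and `ℳ d` is the degree `d` part of `M`; the `z i` are thought of as homogeneous of
degree one. -/
namespace CechLocal

/-- `M_f` for `f = ∏ i ∈ S, z i`, as an `A`-module. -/
abbrev Loc {A : Type*} [CommRing A] {N : ℕ} (z : Fin N → A) (M : Type*) [AddCommGroup M]
    [Module A M] (S : Finset (Fin N)) : Type _ :=
  LocalizedModule (Submonoid.powers (∏ i ∈ S, z i)) M

theorem isUnit_powers_erase {A : Type*} [CommRing A] {N : ℕ} (z : Fin N → A) (M : Type*)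
    [AddCommGroup M] [Module A M] (S : Finset (Fin N)) (i : Fin N) (hi : i ∈ S)
    (x : Submonoid.powers (∏ l ∈ S.erase i, z l)) :
    IsUnit (algebraMap A (Module.End A (Loc z M S)) x) := by
  obtain ⟨_, t, rfl⟩ := x
  have h := IsLocalizedModule.map_units
    (LocalizedModule.mkLinearMap (Submonoid.powers (∏ l ∈ S, z l)) M)
    (Submonoid.pow (∏ l ∈ S, z l) t)
  have e : (∏ l ∈ S, z l) ^ t = (∏ l ∈ S.erase i, z l) ^ t * z i ^ t := by
    rw [← mul_pow, Finset.prod_erase_mul _ _ hi]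
  rw [show ((Submonoid.pow (∏ l ∈ S, z l) t : Submonoid.powers (∏ l ∈ S, z l)) : A) = _ from e,
    map_mul] at h
  exact (Commute.isUnit_mul_iff (Algebra.commutes _ _)).1 h |>.1

/-- The canonical map `M_g → M_f`, where `f = ∏ l ∈ S, z l` and `g` is the same product without
the factor `z i`. -/
def restrict {A : Type*} [CommRing A] {N : ℕ} (z : Fin N → A) (M : Type*) [AddCommGroup M]
    [Module A M] (S : Finset (Fin N)) (i : Fin N) (hi : i ∈ S) :
    Loc z M (S.erase i) →ₗ[A] Loc z M S :=
  LocalizedModule.lift (Submonoid.powers (∏ l ∈ S.erase i, z l))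
    (LocalizedModule.mkLinearMap (Submonoid.powers (∏ l ∈ S, z l)) M)
    (isUnit_powers_erase z M S i hi)

/-- Čech cochains of degree `j`: the direct sum of the `M_{z_{i_1} ⋯ z_{i_j}}` over
`i_1 < ⋯ < i_j`. -/
abbrev Cochain {A : Type*} [CommRing A] {N : ℕ} (z : Fin N → A) (M : Type*) [AddCommGroup M]
    [Module A M] (j : ℕ) : Type _ :=
  (S : {S : Finset (Fin N) // S.card = j}) → Loc z M S.1

/-- The Čech differential: the component at `S` of `diff α` is the sum over `i ∈ S` of
`(-1) ^ #{l ∈ S | l < i}` times the image of `α (S \ {i})`. -/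
def diff {A : Type*} [CommRing A] {N : ℕ} (z : Fin N → A) (M : Type*) [AddCommGroup M]
    [Module A M] (j : ℕ) : Cochain z M j →ₗ[A] Cochain z M (j + 1) :=
  LinearMap.pi fun S => ∑ i : {i // i ∈ S.1},
    ((-1 : A) ^ (S.1.filter (· < i.1)).card) •
      (restrict z M S.1 i.1 i.2 ∘ₗ LinearMap.proj
        (⟨S.1.erase i.1, by rw [Finset.card_erase_of_mem i.2, S.2]; rfl⟩ :
          {S : Finset (Fin N) // S.card = j}))

/-- Čech coboundaries of degree `j`. -/
def coboundaries {A : Type*} [CommRing A] {N : ℕ} (z : Fin N → A) (M : Type*) [AddCommGroup M]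
    [Module A M] : (j : ℕ) → Submodule A (Cochain z M j)
  | 0 => ⊥
  | j + 1 => LinearMap.range (diff z M j)

/-- The local cohomology module `H^j_I(M)` for `I` the ideal generated by the `z i`:
the `j`-th cohomology of the Čech complex of `M` on `z`. -/
abbrev H {A : Type*} [CommRing A] {N : ℕ} (z : Fin N → A) (M : Type*) [AddCommGroup M]
    [Module A M] (j : ℕ) : Type _ :=
  LinearMap.ker (diff z M j) ⧸
    (coboundaries z M j).comap (LinearMap.ker (diff z M j)).subtype

/-- The degree `d` part of `M_f`, `f = ∏ i ∈ S, z i`: it consists of the fractions `w / f ^ t`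
with `w` in `M` homogeneous of degree `d + t * #S`. -/
def locPiece (k : Type*) [Field k] {A : Type*} [CommRing A] [Algebra k A] {N : ℕ}
    (z : Fin N → A) {M : Type*} [AddCommGroup M] [Module A M] [Module k M] [IsScalarTower k A M]
    (ℳ : ℤ → Submodule k M) (S : Finset (Fin N)) (d : ℤ) : Submodule k (Loc z M S) :=
  Submodule.span k {x | ∃ (t : ℕ) (w : M), w ∈ ℳ (d + t * S.card) ∧
    x = LocalizedModule.mk w (Submonoid.pow (∏ i ∈ S, z i) t)}

/-- Čech cochains that are homogeneous of degree `d` in the internal grading. -/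
def cochainPiece (k : Type*) [Field k] {A : Type*} [CommRing A] [Algebra k A] {N : ℕ}
    (z : Fin N → A) {M : Type*} [AddCommGroup M] [Module A M] [Module k M] [IsScalarTower k A M]
    (ℳ : ℤ → Submodule k M) (j : ℕ) (d : ℤ) : Submodule k (Cochain z M j) :=
  Submodule.pi Set.univ fun S => locPiece k z ℳ S.1 d

/-- The degree `d` part `H^j_I(M)_d`: the cohomology classes of the cocycles that are homogeneous
of degree `d`. -/
def HPiece (k : Type*) [Field k] {A : Type*} [CommRing A] [Algebra k A] {N : ℕ}
    (z : Fin N → A) {M : Type*} [AddCommGroup M] [Module A M] [Module k M] [IsScalarTower k A M]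
    (ℳ : ℤ → Submodule k M) (j : ℕ) (d : ℤ) : Submodule k (H z M j) :=
  ((cochainPiece k z ℳ j d).comap ((LinearMap.ker (diff z M j)).subtype.restrictScalars k)).map
    (((coboundaries z M j).comap (LinearMap.ker (diff z M j)).subtype).mkQ.restrictScalars k)

end CechLocal

/-- A `ℤ`-graded module with graded parts `H d` sits in the degrees belonging to `D`. -/
def SitsInDegrees {k M : Type*} [Field k] [AddCommGroup M] [Module k M]
    (H : ℤ → Submodule k M) (D : Set ℤ) : Prop :=
  (∀ d ∉ D, H d = ⊥) ∧ ⨆ d ∈ D, H d = ⊤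

/-- `M_{a mod q}`, the sum of the `M_{a + i q}` over all integers `i`. -/
def modPiece {k M : Type*} [Field k] [AddCommGroup M] [Module k M]
    (H : ℤ → Submodule k M) (a q : ℤ) : Submodule k M :=
  ⨆ i : ℤ, H (a + i * q)

/-! ### Twisted Segre products of the rings `k[x_i, y_i]`

The tensor product over `k` of the `k[x_i, y_i]`, `i : Fin n`, is the polynomial ring
`k[x_1, y_1, …, x_n, y_n]`. The degree `d` part of
`k[x_1, y_1](a_1) # ⋯ # k[x_n, y_n](a_n)`, namely the tensor product of the
`k[x_i, y_i]_{d + a_i}`, is the span of the monomials that for all `i` have degree `d + a_i`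
in the two variables `x_i, y_i`. -/
namespace Segre

/-- `k[x_1, y_1, …, x_n, y_n]`, with `x_i = X (i, 0)` and `y_i = X (i, 1)`. -/
abbrev Poly (k : Type*) [Field k] (n : ℕ) : Type _ := MvPolynomial (Fin n × Fin 2) k

/-- The total degree of a monomial in `x_i` and `y_i`. -/
def pairDeg {n : ℕ} (m : Fin n × Fin 2 →₀ ℕ) (i : Fin n) : ℤ := m (i, 0) + m (i, 1)

/-- The degree `d` part of `k[x_1, y_1](a_1) # ⋯ # k[x_n, y_n](a_n)`. -/
def piece (k : Type*) [Field k] {n : ℕ} (a : Fin n → ℤ) (d : ℤ) : Submodule k (Poly k n) :=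
  MvPolynomial.restrictSupport k {m | ∀ i, pairDeg m i = d + a i}

/-- The underlying `k`-space of `k[x_1, y_1](a_1) # ⋯ # k[x_n, y_n](a_n)`. -/
def total (k : Type*) [Field k] {n : ℕ} (a : Fin n → ℤ) : Submodule k (Poly k n) :=
  MvPolynomial.restrictSupport k {m | ∃ d : ℤ, ∀ i, pairDeg m i = d + a i}

theorem mul_mem_total {k : Type*} [Field k] {n : ℕ} {a b : Fin n → ℤ} {f g : Poly k n}
    (hf : f ∈ total k a) (hg : g ∈ total k b) : f * g ∈ total k (a + b) := by
  classical
  rw [total, MvPolynomial.mem_restrictSupport_iff] at *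
  intro m hm
  obtain ⟨u, hu, v, hv, rfl⟩ := Finset.mem_add.1 (MvPolynomial.support_mul f g hm)
  obtain ⟨d, hd⟩ := hf hu
  obtain ⟨e, he⟩ := hg hv
  refine ⟨d + e, fun i => ?_⟩
  have h1 := hd i
  have h2 := he i
  simp only [pairDeg, Finsupp.add_apply, Nat.cast_add, Pi.add_apply] at *
  omega

theorem one_mem_total (k : Type*) [Field k] (n : ℕ) : (1 : Poly k n) ∈ total k (0 : Fin n → ℤ) := by
  rw [total, MvPolynomial.mem_restrictSupport_iff]
  intro m hm
  have : m = 0 := by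
    by_contra h
    exact h (by simpa using hm)
  exact ⟨0, fun i => by simp [this, pairDeg]⟩

/-- The ring `T_n = k[x_1, y_1] # ⋯ # k[x_n, y_n]`. -/
def T (k : Type*) [Field k] (n : ℕ) : Subalgebra k (Poly k n) :=
  (total k (0 : Fin n → ℤ)).toSubalgebra (one_mem_total k n) fun f g hf hg => by
    simpa using mul_mem_total hf hg

/-- The twisted Segre product `W_q^n = k[x_1, y_1] # k[x_2, y_2](q) # ⋯ # k[x_n, y_n]((n-1)q)`. -/
def W (k : Type*) [Field k] (n q : ℕ) : Type _ := total k fun i : Fin n => (i : ℤ) * q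

instance instWAddCommGroup (k : Type*) [Field k] (n q : ℕ) : AddCommGroup (W k n q) :=
  inferInstanceAs (AddCommGroup (total k fun i : Fin n => (i : ℤ) * q))

instance instWModule (k : Type*) [Field k] (n q : ℕ) : Module k (W k n q) :=
  inferInstanceAs (Module k (total k fun i : Fin n => (i : ℤ) * q))

/-- The inclusion of `W_q^n` into the polynomial ring. -/
def WIncl (k : Type*) [Field k] (n q : ℕ) : W k n q →ₗ[k] Poly k n :=
  (total k fun i : Fin n => (i : ℤ) * q).subtype

/-- `T_n` acts on `W_q^n` by multiplication of polynomials. -/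
instance instWModuleT (k : Type*) [Field k] (n q : ℕ) : Module (T k n) (W k n q) where
  smul c x := (⟨(c : Poly k n) * WIncl k n q x, by
    have h := mul_mem_total c.2 x.2
    rwa [zero_add] at h⟩ : total k fun i : Fin n => (i : ℤ) * q)
  one_smul x := Subtype.ext (one_mul (WIncl k n q x))
  mul_smul c d x := Subtype.ext (mul_assoc (c : Poly k n) d (WIncl k n q x))
  smul_zero c := Subtype.ext (mul_zero (c : Poly k n))
  smul_add c x y := Subtype.ext (mul_add (c : Poly k n) (WIncl k n q x) (WIncl k n q y))
  add_smul c d x := Subtype.ext (add_mul (c : Poly k n) d (WIncl k n q x))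
  zero_smul x := Subtype.ext (zero_mul (WIncl k n q x))

instance instWTower (k : Type*) [Field k] (n q : ℕ) : IsScalarTower k (T k n) (W k n q) :=
  ⟨fun c t x => Subtype.ext (smul_mul_assoc c (t : Poly k n) (WIncl k n q x))⟩

/-- The degree `d` part of `W_q^n`. -/
def WPiece (k : Type*) [Field k] (n q : ℕ) (d : ℤ) : Submodule k (W k n q) :=
  (piece k (fun i : Fin n => (i : ℤ) * q) d).comap (WIncl k n q)

/-- The `k`-subalgebra `A_n = k[z_1, …, z_{n+1}]` of `T_n`. -/
def A {k : Type*} [Field k] {n : ℕ} (z : Fin (n + 1) → T k n) : Subalgebra k (T k n) :=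
  Algebra.adjoin k (Set.range z)

/-- The `z_i` as elements of `A_n`; they generate its homogeneous maximal ideal `𝔪`. -/
def gens {k : Type*} [Field k] {n : ℕ} (z : Fin (n + 1) → T k n) (i : Fin (n + 1)) : A z :=
  ⟨z i, Algebra.subset_adjoin ⟨i, rfl⟩⟩

instance instWModuleA {k : Type*} [Field k] {n : ℕ} (z : Fin (n + 1) → T k n) (q : ℕ) :
    Module (A z) (W k n q) :=
  Subalgebra.moduleLeft (A z)

instance instWTowerA {k : Type*} [Field k] {n : ℕ} (z : Fin (n + 1) → T k n) (q : ℕ) :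
    IsScalarTower k (A z) (W k n q) :=
  ⟨fun c a w => smul_assoc c (a : T k n) w⟩

/-- The local cohomology module `H^j_𝔪(W_q^n)` over `A_n`. -/
abbrev HW {k : Type*} [Field k] {n : ℕ} (z : Fin (n + 1) → T k n) (q j : ℕ) : Type _ :=
  CechLocal.H (gens z) (W k n q) j

/-- Its degree `d` part `H^j_𝔪(W_q^n)_d`. -/
def HWPiece {k : Type*} [Field k] {n : ℕ} (z : Fin (n + 1) → T k n) (q j : ℕ) (d : ℤ) :
    Submodule k (HW z q j) :=
  CechLocal.HPiece k (gens z) (WPiece k n q) j d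

end Segre

end

-- For j ≥ 2 the space H^j_𝔪(W_q^n)_d is geometrically H^{j-1}((P^1)^n, O(d, d+q, …, d+(n-1)q)). By
-- Künneth this is spanned by Laurent monomials in which exactly j-1 pairs (x_i, y_i) have both
-- exponents negative and all other pairs have both exponents nonnegative. The i-th pair (i = 0, …,
-- n-1) has total degree d+iq, so it is negative exactly when d+iq < 0. The negative pairs thus form
-- an initial segment determined by d, which gives the ranges of degrees in (a) and (b). The number
-- of monomials is at most a product of factors of size about |d+iq|. In degree -(j-2)q-r one factor
-- stays bounded, so the count is O(q^{n-1}); in degree -(n+t)q-r it is O(q^n). In a residue class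
-- mod q with q ≥ r, only the degree -(j-2)q-r can contribute for 2 ≤ j ≤ n, which is (d).
--
-- Only upper bounds are needed, and they are obtained without sheaves. All localizations are
-- embedded in the field of rational functions, where restriction maps become inclusions. W_q^n is
-- resolved by D, the product of the n two-term Čech complexes that invert x_i, y_i or both. Each
-- term of D inverts a variable of every pair, hence a degree-one monomial u of T_n. Finiteness of
-- T_n over A_n puts a power of u in the ideal of the z_i^t (`exists_pow_eq_sum`), so the Čech
-- complex of that term on z is exact (`Fam.Contractible.cocyc_le_cobdy`). D itself is exact in
-- internal degrees ≥ 0, hence after inverting any z_i. Dimension shifting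
-- (`AcyclicComplex.hdim_Z_le`) then bounds H^{l+2}_𝔪(W_q^n)_d by H^{l+1}(D)_d.
--
-- H^{l+1}(D)_d is bounded one multidegree at a time by explicit homotopies
-- (`PairCech.exists_diff_eq`), giving `dim_dComplex_le`. The counting is in
-- `exists_card_specialExp_le` and `specialExp_shift_bounds`. The vanishing of H^0 and H^1 comes
-- from the same setup, and `iSup_HPiece_eq_top` shows that the homogeneous parts span the
-- cohomology.

universe u

set_option linter.unusedSectionVars false

noncomputable section

/-! ### Signs -/

namespace AltSign

variable {N : ℕ}

/-- The sign `(-1) ^ #{l ∈ T | l < i}`. -/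
def sgn (T : Finset (Fin N)) (i : Fin N) : ℤ := (-1) ^ (T.filter (· < i)).card

theorem sgn_mul_self (T : Finset (Fin N)) (i : Fin N) : sgn T i * sgn T i = 1 := by
  rw [sgn, ← pow_add, ← two_mul, pow_mul]; simp

theorem sgn_erase_self (T : Finset (Fin N)) (i : Fin N) : sgn (T.erase i) i = sgn T i := by
  unfold sgn
  congr 2
  ext l
  simp only [Finset.mem_filter, Finset.mem_erase]
  constructor
  · rintro ⟨⟨_, h⟩, h'⟩; exact ⟨h, h'⟩
  · rintro ⟨h, h'⟩; exact ⟨⟨h'.ne, h⟩, h'⟩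

theorem sgn_insert_self (T : Finset (Fin N)) (i : Fin N) : sgn (insert i T) i = sgn T i := by
  rw [← sgn_erase_self, Finset.erase_insert_eq_erase, sgn_erase_self]

theorem sgn_erase_of_lt {T : Finset (Fin N)} {i l : Fin N} (h : i < l) :
    sgn (T.erase l) i = sgn T i := by
  unfold sgn
  congr 2
  ext m
  simp only [Finset.mem_filter, Finset.mem_erase]
  constructor
  · rintro ⟨⟨_, h⟩, h'⟩; exact ⟨h, h'⟩
  · rintro ⟨h1, h'⟩; exact ⟨⟨(h'.trans h).ne, h1⟩, h'⟩

theorem sgn_erase_of_gt {T : Finset (Fin N)} {i l : Fin N} (hi : i ∈ T) (h : i < l) :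
    sgn T l = -sgn (T.erase i) l := by
  unfold sgn
  have : T.filter (· < l) = insert i ((T.erase i).filter (· < l)) := by
    ext m
    simp only [Finset.mem_filter, Finset.mem_erase, Finset.mem_insert]
    constructor
    · rintro ⟨h1, h2⟩
      by_cases hm : m = i
      · exact Or.inl hm
      · exact Or.inr ⟨⟨hm, h1⟩, h2⟩
    · rintro (rfl | ⟨⟨_, h1⟩, h2⟩)
      · exact ⟨hi, h⟩
      · exact ⟨h1, h2⟩
  rw [this, Finset.card_insert_of_notMem (by simp), pow_succ]
  ring

/-- Deleting the smaller index changes the sign of the larger one and not conversely. This is the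
source of both squared differentials being zero. -/
theorem sgn_swap {T : Finset (Fin N)} {i l : Fin N} (hi : i ∈ T) (hl : l ∈ T) (hil : i ≠ l) :
    sgn T i * sgn (T.erase i) l = -(sgn T l * sgn (T.erase l) i) := by
  rcases lt_or_gt_of_ne hil with h | h
  · rw [sgn_erase_of_lt h, sgn_erase_of_gt hi h]; ring
  · rw [sgn_erase_of_lt h, sgn_erase_of_gt hl h]; ring

theorem sgn_swap' {T : Finset (Fin N)} {i l : Fin N} (hi : i ∈ T) (hl : l ∈ T) (hil : i ≠ l) :
    sgn (T.erase i) l * sgn (T.erase l) i = -(sgn T i * sgn T l) := by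
  have h := congrArg (fun x => sgn T i * sgn (T.erase l) i * x) (sgn_swap hi hl hil)
  linear_combination h + (-sgn (T.erase i) l * sgn (T.erase l) i) * sgn_mul_self T i
    - (sgn T i * sgn T l) * sgn_mul_self (T.erase l) i

/-- The terms (i, l) and (l, i) cancel. Both the Čech differential on subsets and the differential
of the pair complex square to zero through this identity. -/
theorem sum_sgn_sgn_eq_zero {X : Type*} [AddCommGroup X] (T : Finset (Fin N))
    (g : Fin N → Fin N → X) (hg : ∀ i l, i ≠ l → g i l = g l i) :
    ∑ i ∈ T, sgn T i • ∑ l ∈ T.erase i, sgn (T.erase i) l • g i l = 0 := by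
  simp only [Finset.smul_sum, smul_smul]
  rw [Finset.sum_sigma']
  refine Finset.sum_involution (fun x _ => ⟨x.2, x.1⟩) ?_ ?_ ?_ ?_
  · rintro ⟨i, l⟩ h
    simp only [Finset.mem_sigma, Finset.mem_erase] at h
    obtain ⟨hi, hli, hl⟩ := h
    simp only
    rw [sgn_swap hi hl hli.symm, hg i l hli.symm, ← add_smul]
    simp
  · rintro ⟨i, l⟩ h _ h'
    simp only [Finset.mem_sigma, Finset.mem_erase] at h
    simp only [Sigma.mk.injEq] at h'
    exact h.2.1 h'.1
  · rintro ⟨i, l⟩ h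
    simp only [Finset.mem_sigma, Finset.mem_erase] at h ⊢
    exact ⟨h.2.2, h.2.1.symm, h.1⟩
  · rintro ⟨i, l⟩ _
    rfl

end AltSign

/-! ### Dimensions of subquotients -/

namespace Subquot

variable {k : Type*} [Field k]

/-- The dimension of `P / (P ∩ Q)`. -/
def dim {X : Type*} [AddCommGroup X] [Module k X] (P Q : Submodule k X) : Cardinal :=
  Module.rank k (P ⧸ Q.comap P.subtype)

/-- A linear relation stands in for a map, so connecting homomorphisms can be used without checking
that they are independent of choices: R projects onto X and injects into Y. -/
theorem rank_le_of_rel {X Y : Type u} [AddCommGroup X] [Module k X]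
    [AddCommGroup Y] [Module k Y] (R : Submodule k (X × Y)) (h1 : ∀ x, ∃ y, (x, y) ∈ R)
    (h2 : ∀ x, (x, 0) ∈ R → x = 0) : Module.rank k X ≤ Module.rank k Y := by
  have hs : Function.Surjective (LinearMap.fst k X Y ∘ₗ R.subtype) := fun x => by
    obtain ⟨y, hy⟩ := h1 x
    exact ⟨⟨(x, y), hy⟩, rfl⟩
  have hi : Function.Injective (LinearMap.snd k X Y ∘ₗ R.subtype) := by
    rw [← LinearMap.ker_eq_bot, LinearMap.ker_eq_bot']
    rintro ⟨⟨x, y⟩, hxy⟩ h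
    change y = 0 at h
    subst h
    have := h2 x hxy
    subst this
    rfl
  exact (LinearMap.rank_le_of_surjective _ hs).trans (LinearMap.rank_le_of_injective _ hi)

theorem rank_le_dim_of_rel {X Y : Type u} [AddCommGroup X] [Module k X]
    [AddCommGroup Y] [Module k Y] (P Q : Submodule k Y) (R : Submodule k (X × Y))
    (h1 : ∀ x, ∃ y ∈ P, (x, y) ∈ R) (h2 : ∀ x y, y ∈ P → (x, y) ∈ R → y ∈ Q → x = 0) :
    Module.rank k X ≤ dim P Q := by
  refine rank_le_of_rel
    ((R.comap (LinearMap.prodMap LinearMap.id P.subtype)).map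
      (LinearMap.prodMap LinearMap.id (Q.comap P.subtype).mkQ)) (fun x => ?_) (fun x hx => ?_)
  · obtain ⟨y, hy, hxy⟩ := h1 x
    exact ⟨_, ⟨(x, ⟨y, hy⟩), hxy, rfl⟩⟩
  · obtain ⟨⟨x', y⟩, hxy, h⟩ := hx
    simp only [LinearMap.prodMap_apply, LinearMap.id_coe, id_eq, Prod.mk.injEq] at h
    obtain ⟨rfl, h⟩ := h
    rw [Submodule.mkQ_apply, Submodule.Quotient.mk_eq_zero] at h
    exact h2 _ _ y.2 hxy h

theorem dim_le_dim_of_rel {X Y : Type u} [AddCommGroup X] [Module k X]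
    [AddCommGroup Y] [Module k Y] (P Q : Submodule k X) (P' Q' : Submodule k Y)
    (R : Submodule k (X × Y))
    (h1 : ∀ x ∈ P, ∃ y ∈ P', (x, y) ∈ R)
    (h2 : ∀ x y, x ∈ P → y ∈ P' → (x, y) ∈ R → y ∈ Q' → x ∈ Q) :
    dim P Q ≤ dim P' Q' := by
  refine rank_le_dim_of_rel P' Q'
    ((R.comap (LinearMap.prodMap P.subtype LinearMap.id)).map
      (LinearMap.prodMap (Q.comap P.subtype).mkQ LinearMap.id)) (fun x => ?_)
      (fun x y hy hx hyQ => ?_)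
  · obtain ⟨x, rfl⟩ := Submodule.mkQ_surjective _ x
    obtain ⟨y, hy, hxy⟩ := h1 x x.2
    exact ⟨y, hy, ⟨(x, y), hxy, rfl⟩⟩
  · obtain ⟨⟨x', y'⟩, hxy, h⟩ := hx
    simp only [LinearMap.prodMap_apply, LinearMap.id_coe, id_eq, Prod.mk.injEq] at h
    obtain ⟨rfl, rfl⟩ := h
    rw [Submodule.mkQ_apply, Submodule.Quotient.mk_eq_zero]
    exact h2 _ _ x'.2 hy hxy hyQ

theorem dim_eq_zero {X : Type*} [AddCommGroup X] [Module k X] {P Q : Submodule k X}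
    (h : P ≤ Q) : dim P Q = 0 := by
  unfold dim
  rw [rank_zero_iff]
  refine ⟨fun x y => ?_⟩
  obtain ⟨x, rfl⟩ := Submodule.mkQ_surjective _ x
  obtain ⟨y, rfl⟩ := Submodule.mkQ_surjective _ y
  exact (Submodule.Quotient.eq _).2 (h (x - y).2)

/-- P / (P ∩ Q) is a quotient of P / ker f, which embeds in k^ι. -/
theorem dim_le_card {X : Type u} [AddCommGroup X] [Module k X] (P Q : Submodule k X)
    {ι : Type} [Fintype ι] (f : P →ₗ[k] (ι → k)) (h : ∀ x, f x = 0 → (x : X) ∈ Q) :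
    dim P Q ≤ Fintype.card ι := by
  have h1 : dim P Q ≤ Module.rank k (P ⧸ LinearMap.ker f) := by
    have hle : LinearMap.ker f ≤ Q.comap P.subtype := fun x hx => h x hx
    exact LinearMap.rank_le_of_surjective (Submodule.factor hle) (Submodule.factor_surjective hle)
  have h2 := LinearMap.lift_rank_le_of_injective
    ((LinearMap.ker f).liftQ f le_rfl) (LinearMap.ker_eq_bot.1 (Submodule.ker_liftQ_eq_bot _ _ _ le_rfl))
  rw [rank_fun'] at h2
  refine h1.trans ?_
  have : Cardinal.lift.{_} (Module.rank k (P ⧸ LinearMap.ker f)) ≤ Cardinal.lift (Fintype.card ι : Cardinal) := h2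
  simpa using this

end Subquot
end

noncomputable section

open AltSign

/-! ### The Čech complex of a graded family of subspaces of a vector space -/

namespace CechVec

/-- The Čech differential on all functions on subsets of `Fin N`. -/
def delta (R : Type*) [Ring R] (N : ℕ) (E : Type*) [AddCommGroup E] [Module R E] :
    (Finset (Fin N) → E) →ₗ[R] (Finset (Fin N) → E) :=
  LinearMap.pi fun S => ∑ i ∈ S, sgn S i • LinearMap.proj (S.erase i)

theorem delta_apply {R : Type*} [Ring R] {N : ℕ} {E : Type*} [AddCommGroup E] [Module R E]
    (α : Finset (Fin N) → E) (S : Finset (Fin N)) :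
    delta R N E α S = ∑ i ∈ S, sgn S i • α (S.erase i) := by
  simp [delta, LinearMap.sum_apply]

theorem delta_delta {R : Type*} [Ring R] {N : ℕ} {E : Type*} [AddCommGroup E] [Module R E]
    (α : Finset (Fin N) → E) : delta R N E (delta R N E α) = 0 := by
  funext S
  simp only [delta_apply]
  exact sum_sgn_sgn_eq_zero S (fun i l => α ((S.erase i).erase l))
    fun i l _ => by rw [Finset.erase_right_comm]

theorem delta_comp {R : Type*} [Ring R] {N : ℕ} {E F : Type*} [AddCommGroup E] [Module R E]
    [AddCommGroup F] [Module R F] (f : E →ₗ[R] F) (α : Finset (Fin N) → E) :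
    delta R N F (fun S => f (α S)) = fun S => f (delta R N E α S) := by
  funext S
  simp [delta_apply]

/-- The contracting homotopy of the Čech complex that inserts the index `i`. -/
def homotopy {N : ℕ} {E : Type*} [AddCommGroup E] (i : Fin N) (α : Finset (Fin N) → E) :
    Finset (Fin N) → E :=
  fun S => if i ∈ S then 0 else sgn S i • α (insert i S)

/-- On a cocycle the identity δh + hδ = 1 reduces to δhα = α. The catch is that hα at S lies only in
the localization at `insert i S`, so h does not preserve localized cochains until the powers of ζ i
in the denominators are cleared. -/
theorem delta_homotopy {R : Type*} [Ring R] {N : ℕ} {E : Type*} [AddCommGroup E] [Module R E]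
    (i : Fin N) (α : Finset (Fin N) → E) (hα : delta R N E α = 0) :
    delta R N E (homotopy i α) = α := by
  funext S
  rw [delta_apply]
  by_cases hi : i ∈ S
  · rw [Finset.sum_eq_single_of_mem i hi]
    · simp only [homotopy, Finset.notMem_erase, if_false, Finset.insert_erase hi, sgn_erase_self,
        smul_smul, sgn_mul_self, one_smul]
    · intro l _ hl
      have : i ∈ S.erase l := Finset.mem_erase.2 ⟨hl.symm, hi⟩
      simp [homotopy, this]
  · have h := congrFun hα (insert i S)
    rw [delta_apply, Finset.sum_insert hi, Finset.erase_insert hi, sgn_insert_self,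
      Pi.zero_apply] at h
    have h' := congrArg (fun x => sgn S i • x) h
    simp only [smul_add, smul_smul, sgn_mul_self, one_smul, smul_zero, Finset.smul_sum] at h'
    rw [eq_neg_of_add_eq_zero_left h', ← Finset.sum_neg_distrib]
    refine Finset.sum_congr rfl fun l hl => ?_
    have hil : i ≠ l := fun h => hi (h ▸ hl)
    have h1 : i ∉ S.erase l := fun h => hi (Finset.mem_of_mem_erase h)
    have h2 := sgn_swap' (Finset.mem_insert_self i S) (Finset.mem_insert_of_mem hl) hil
    rw [Finset.erase_insert hi, sgn_insert_self, Finset.erase_insert_of_ne hil,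
      sgn_insert_self] at h2
    simp only [homotopy, h1, if_false, smul_smul, h2, neg_smul, Finset.erase_insert_of_ne hil]

/-- All values lie in one space E, so δ on cochains concentrated at ∅ merely copies the value with a
sign and is injective. -/
theorem eq_zero_of_delta_eq_zero {R : Type*} [Ring R] {N : ℕ} (hN : 0 < N) {E : Type*}
    [AddCommGroup E] [Module R E] {α : Finset (Fin N) → E} (h : ∀ S, S ≠ ∅ → α S = 0)
    (hα : delta R N E α = 0) : α = 0 := by
  funext S
  by_cases hS : S = ∅
  · subst hS
    have h := congrFun hα {⟨0, hN⟩}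
    rw [delta_apply, Finset.sum_singleton, Finset.erase_singleton] at h
    have h' := congrArg (fun x => sgn {(⟨0, hN⟩ : Fin N)} ⟨0, hN⟩ • x) h
    simpa only [smul_smul, sgn_mul_self, one_smul, Pi.zero_apply, smul_zero] using h'
  · exact h S hS

/-- A graded family of `k`-subspaces of the `K`-space `E` on which the `ζ i ∈ K` act with
degree one. -/
structure Fam (k : Type*) {K : Type*} (E : Type*) [Field k] [Field K] [AddCommGroup E]
    [Module K E] [Module k E] {N : ℕ} (ζ : Fin N → K) where
  /-- The degree `d` part. -/
  gr : ℤ → Submodule k E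
  smul_mem' : ∀ i d v, v ∈ gr d → ζ i • v ∈ gr (d + 1)

variable {k K E : Type u} [Field k] [Field K] [Algebra k K] [AddCommGroup E]
  [Module K E] [Module k E] [IsScalarTower k K E] {N : ℕ} {ζ : Fin N → K}

namespace Fam

theorem pow_smul_mem (M : Fam k E ζ) (i : Fin N) (t : ℕ) (d : ℤ) {v : E} (hv : v ∈ M.gr d) :
    ζ i ^ t • v ∈ M.gr (d + t) := by
  induction t with
  | zero => simpa using hv
  | succ t ih =>
    rw [pow_succ', mul_smul]
    have := M.smul_mem' i _ _ ih
    rwa [add_assoc] at this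

theorem prod_smul_mem (M : Fam k E ζ) (S : Finset (Fin N)) (t : ℕ) (d : ℤ) {v : E}
    (hv : v ∈ M.gr d) : (∏ i ∈ S, ζ i) ^ t • v ∈ M.gr (d + t * S.card) := by
  induction S using Finset.induction_on with
  | empty => simpa using hv
  | insert i S hi ih =>
    rw [Finset.prod_insert hi, mul_pow, mul_smul, Finset.card_insert_of_notMem hi]
    have := M.pow_smul_mem i t _ ih
    convert this using 2
    push_cast; ring

theorem prod_smul_mem_add (M : Fam k E ζ) (S : Finset (Fin N)) (t s : ℕ) (d : ℤ) {v : E}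
    (hv : (∏ i ∈ S, ζ i) ^ t • v ∈ M.gr (d + t * S.card)) :
    (∏ i ∈ S, ζ i) ^ (t + s) • v ∈ M.gr (d + (t + s : ℕ) * S.card) := by
  have := M.prod_smul_mem S s _ hv
  rw [smul_smul, ← pow_add] at this
  rw [add_comm t s]
  convert this using 2
  push_cast; ring

/-- The degree `d` part of the localization of the family at `∏ i ∈ S, ζ i`. -/
def loc (M : Fam k E ζ) (S : Finset (Fin N)) (d : ℤ) : Submodule k E where
  carrier := {v | ∃ t : ℕ, (∏ i ∈ S, ζ i) ^ t • v ∈ M.gr (d + t * S.card)}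
  zero_mem' := ⟨0, by rw [smul_zero]; exact zero_mem _⟩
  add_mem' := by
    rintro v w ⟨t, ht⟩ ⟨s, hs⟩
    refine ⟨t + s, ?_⟩
    rw [smul_add]
    refine add_mem (M.prod_smul_mem_add S t s d ht) ?_
    rw [add_comm t s]
    exact M.prod_smul_mem_add S s t d hs
  smul_mem' := by
    rintro c v ⟨t, ht⟩
    exact ⟨t, by rw [smul_comm]; exact Submodule.smul_mem _ c ht⟩

theorem mem_loc {M : Fam k E ζ} {S : Finset (Fin N)} {d : ℤ} {v : E} :
    v ∈ M.loc S d ↔ ∃ t : ℕ, (∏ i ∈ S, ζ i) ^ t • v ∈ M.gr (d + t * S.card) := Iff.rfl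

theorem loc_empty (M : Fam k E ζ) (d : ℤ) : M.loc ∅ d = M.gr d := by
  ext v
  simp [mem_loc]

theorem loc_le_of_map {F : Type u} [AddCommGroup F] [Module K F] [Module k F]
    [IsScalarTower k K F] (M : Fam k E ζ) (M' : Fam k F ζ) (f : E →ₗ[K] F)
    (h : ∀ d v, v ∈ M.gr d → f v ∈ M'.gr d) {S : Finset (Fin N)} {d : ℤ} {v : E}
    (hv : v ∈ M.loc S d) : f v ∈ M'.loc S d := by
  obtain ⟨t, ht⟩ := hv
  exact ⟨t, by rw [← map_smul]; exact h _ _ ht⟩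

theorem loc_mono_insert (M : Fam k E ζ) {S : Finset (Fin N)} {i : Fin N} (hi : i ∉ S) {d : ℤ}
    {v : E} (hv : v ∈ M.loc S d) : v ∈ M.loc (insert i S) d := by
  obtain ⟨t, ht⟩ := hv
  refine ⟨t, ?_⟩
  rw [Finset.prod_insert hi, mul_pow, mul_smul, Finset.card_insert_of_notMem hi]
  convert M.pow_smul_mem i t _ ht using 2
  push_cast; ring

theorem loc_erase_le (M : Fam k E ζ) {S : Finset (Fin N)} {i : Fin N} (hi : i ∈ S) {d : ℤ}
    {v : E} (hv : v ∈ M.loc (S.erase i) d) : v ∈ M.loc S d := by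
  have := M.loc_mono_insert (Finset.notMem_erase i S) hv
  rwa [Finset.insert_erase hi] at this

/-- Clearing the denominator `ζ i`. -/
theorem exists_pow_smul_mem_loc (M : Fam k E ζ) {S : Finset (Fin N)} {i : Fin N} (hi : i ∉ S)
    {d : ℤ} {v : E} (hv : v ∈ M.loc (insert i S) d) :
    ∃ t₀ : ℕ, ∀ t ≥ t₀, ζ i ^ t • v ∈ M.loc S (d + t) := by
  obtain ⟨t, ht⟩ := hv
  refine ⟨t, fun s hs => ⟨t, ?_⟩⟩
  obtain ⟨r, rfl⟩ := Nat.exists_eq_add_of_le hs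
  rw [Finset.prod_insert hi, mul_pow, Finset.card_insert_of_notMem hi] at ht
  have := M.pow_smul_mem i r _ ht
  rw [smul_smul] at this ⊢
  rw [← mul_assoc, ← pow_add, add_comm r t] at this
  rw [mul_comm (_ ^ t) (ζ i ^ (t + r))]
  convert this using 2
  push_cast; ring

/-- Čech cochains of degree `j` and internal degree `d`. -/
def coch (M : Fam k E ζ) (j d : ℤ) : Submodule k (Finset (Fin N) → E) where
  carrier := {α | ∀ S, ((S.card : ℤ) = j → α S ∈ M.loc S d) ∧ ((S.card : ℤ) ≠ j → α S = 0)}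
  zero_mem' := fun S => ⟨fun _ => zero_mem _, fun _ => rfl⟩
  add_mem' := by
    intro a b ha hb S
    exact ⟨fun h => add_mem ((ha S).1 h) ((hb S).1 h),
      fun h => by rw [Pi.add_apply, (ha S).2 h, (hb S).2 h, add_zero]⟩
  smul_mem' := by
    intro c a ha S
    exact ⟨fun h => Submodule.smul_mem _ c ((ha S).1 h),
      fun h => by rw [Pi.smul_apply, (ha S).2 h, smul_zero]⟩

theorem mem_coch {M : Fam k E ζ} {j d : ℤ} {α : Finset (Fin N) → E} :
    α ∈ M.coch j d ↔
      ∀ S, ((S.card : ℤ) = j → α S ∈ M.loc S d) ∧ ((S.card : ℤ) ≠ j → α S = 0) := Iff.rfl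

/-- Čech cocycles. -/
def cocyc (M : Fam k E ζ) (j d : ℤ) : Submodule k (Finset (Fin N) → E) :=
  M.coch j d ⊓ LinearMap.ker (delta k N E)

/-- Čech coboundaries. -/
def cobdy (M : Fam k E ζ) (j d : ℤ) : Submodule k (Finset (Fin N) → E) :=
  (M.coch (j - 1) d).map (delta k N E)

theorem mem_cocyc {M : Fam k E ζ} {j d : ℤ} {α : Finset (Fin N) → E} :
    α ∈ M.cocyc j d ↔ α ∈ M.coch j d ∧ delta k N E α = 0 := Iff.rfl

theorem delta_mem_coch (M : Fam k E ζ) {j d : ℤ} {α : Finset (Fin N) → E}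
    (hα : α ∈ M.coch (j - 1) d) : delta k N E α ∈ M.coch j d := by
  intro S
  rw [delta_apply]
  refine ⟨fun hS => Submodule.sum_mem _ fun i hi => zsmul_mem (M.loc_erase_le hi ?_) _,
    fun hS => Finset.sum_eq_zero fun i hi => ?_⟩
  · refine (hα _).1 ?_
    have := Finset.card_erase_add_one hi
    omega
  · rw [(hα _).2, smul_zero]
    have := Finset.card_erase_add_one hi
    omega

/-- The dimension of the degree `d` part of the `j`-th Čech cohomology. -/
def hdim (M : Fam k E ζ) (j d : ℤ) : Cardinal := Subquot.dim (M.cocyc j d) (M.cobdy j d)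

/-- A family is contractible if there are partitions of unity by high powers of the `ζ i`. -/
def Contractible (M : Fam k E ζ) : Prop :=
  ∀ t : ℕ, ∃ e : Fin N → (E →ₗ[K] E), (∀ v, ∑ i, ζ i ^ t • e i v = v) ∧
    ∀ i d v, v ∈ M.gr d → e i v ∈ M.gr (d - t)

/-- With t large, ζ i ^ t clears the denominators that the homotopy at i introduces. The partition
of unity then glues: the cochain ∑ e i (ζ i ^ t h_i α) is admissible and has coboundary ∑ ζ i ^ t e
i (α) = α. -/
theorem Contractible.cocyc_le_cobdy {M : Fam k E ζ} (hM : M.Contractible) {j d : ℤ} :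
    M.cocyc j d ≤ M.cobdy j d := by
  intro α hα
  obtain ⟨hα, hδ⟩ := mem_cocyc.1 hα
  have key : ∀ (i : Fin N) (S : Finset (Fin N)), ∃ t₀ : ℕ, ∀ t ≥ t₀,
      (S.card : ℤ) = j - 1 → ζ i ^ t • homotopy i α S ∈ M.loc S (d + t) := by
    intro i S
    by_cases hi : i ∈ S
    · exact ⟨0, fun t _ _ => by simp [homotopy, hi]⟩
    · by_cases hS : (S.card : ℤ) = j - 1
      · have hS' : ((insert i S).card : ℤ) = j := by
          rw [Finset.card_insert_of_notMem hi]; push_cast; omega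
        obtain ⟨t₀, h⟩ := M.exists_pow_smul_mem_loc hi ((hα _).1 hS')
        refine ⟨t₀, fun t ht _ => ?_⟩
        simp only [homotopy, hi, if_false]
        rw [smul_comm]
        exact zsmul_mem (h t ht) _
      · exact ⟨0, fun t _ h => absurd h hS⟩
  choose t₀ ht₀ using key
  -- A single exponent that dominates every t₀ i S.
  set t := ∑ i, ∑ S, t₀ i S with ht
  have hle : ∀ i S, t₀ i S ≤ t := fun i S =>
    (Finset.single_le_sum (f := fun S => t₀ i S) (fun _ _ => Nat.zero_le _)
      (Finset.mem_univ S)).trans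
    (Finset.single_le_sum (f := fun i => ∑ S, t₀ i S) (fun _ _ => Nat.zero_le _)
      (Finset.mem_univ i))
  obtain ⟨e, he1, he2⟩ := hM t
  refine ⟨∑ i, fun S => e i (ζ i ^ t • homotopy i α S), ?_, ?_⟩
  · refine Submodule.sum_mem _ fun i _ S => ⟨fun hS => ?_, fun hS => ?_⟩
    · obtain ⟨s, hs⟩ := ht₀ i S t (hle i S) hS
      refine ⟨s, ?_⟩
      rw [← map_smul]
      convert he2 i _ _ hs using 2
      ring
    · simp only [homotopy]
      split_ifs with hi
      · simp
      · rw [(hα _).2]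
        · simp
        · rw [Finset.card_insert_of_notMem hi]; push_cast; omega
  · rw [map_sum]
    have : ∀ i, delta k N E (fun S => e i (ζ i ^ t • homotopy i α S)) =
        fun S => ζ i ^ t • e i (α S) := by
      intro i
      have h1 := delta_comp ((e i ∘ₗ LinearMap.lsmul K E (ζ i ^ t)).restrictScalars k)
        (homotopy i α)
      rw [delta_homotopy i α hδ] at h1
      refine h1.trans ?_
      funext S
      simp
    simp only [this]
    funext S
    simp [he1]

end Fam

/-! ### The double complex argument -/

/-- A graded complex of contractible families that is exact in positive cohomological and
nonnegative internal degrees. -/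
structure AcyclicComplex (k : Type u) {K : Type u} (E : Type u) [Field k] [Field K] [Algebra k K]
    [AddCommGroup E] [Module K E] [Module k E] [IsScalarTower k K E] {N : ℕ} (ζ : Fin N → K) where
  /-- The terms of the complex. -/
  D : ℕ → Fam k E ζ
  /-- The differential. -/
  diff : E →ₗ[K] E
  diff_diff : ∀ v, diff (diff v) = 0
  diff_mem : ∀ q d v, v ∈ (D q).gr d → diff v ∈ (D (q + 1)).gr d
  contractible : ∀ q, (D q).Contractible
  exact : ∀ q d v, 0 ≤ d → v ∈ (D (q + 1)).gr d → diff v = 0 → ∃ w ∈ (D q).gr d, diff w = v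

namespace AcyclicComplex

variable (C : AcyclicComplex k E ζ)

/-- The cocycles of the complex. -/
def Z (q : ℕ) : Fam k E ζ where
  gr d := (C.D q).gr d ⊓ LinearMap.ker (C.diff.restrictScalars k)
  smul_mem' i d v hv := ⟨(C.D q).smul_mem' i d v hv.1, by
    have h : C.diff v = 0 := hv.2
    change C.diff _ = 0
    rw [map_smul, h, smul_zero]⟩

/-- The images of the differential. -/
def B (q : ℕ) : Fam k E ζ where
  gr d := ((C.D q).gr d).map (C.diff.restrictScalars k)
  smul_mem' i d v hv := by
    obtain ⟨w, hw, rfl⟩ := hv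
    exact ⟨ζ i • w, (C.D q).smul_mem' i d w hw, by simp⟩

theorem B_le_Z (q : ℕ) (d : ℤ) {v : E} (hv : v ∈ (C.B q).gr d) : v ∈ (C.Z (q + 1)).gr d := by
  obtain ⟨w, hw, rfl⟩ := hv
  exact ⟨C.diff_mem _ _ _ hw, C.diff_diff w⟩

theorem mem_loc_Z (hζ : ∀ i, ζ i ≠ 0) {q : ℕ} {S : Finset (Fin N)} {d : ℤ} {v : E} :
    v ∈ (C.Z q).loc S d ↔ v ∈ (C.D q).loc S d ∧ C.diff v = 0 := by
  constructor
  · rintro ⟨t, h1, h2⟩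
    refine ⟨⟨t, h1⟩, ?_⟩
    change C.diff _ = 0 at h2
    rw [map_smul] at h2
    exact (smul_eq_zero.1 h2).resolve_left (pow_ne_zero _ (Finset.prod_ne_zero_iff.2 fun i _ => hζ i))
  · rintro ⟨⟨t, h1⟩, h2⟩
    refine ⟨t, h1, ?_⟩
    change C.diff _ = 0
    rw [map_smul, h2, smul_zero]

/-- Images commute with localization, since denominators are invertible in K and the differential is
K-linear. -/
theorem mem_loc_B (hζ : ∀ i, ζ i ≠ 0) {q : ℕ} {S : Finset (Fin N)} {d : ℤ} {v : E} :
    v ∈ (C.B q).loc S d ↔ ∃ w ∈ (C.D q).loc S d, C.diff w = v := by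
  constructor
  · rintro ⟨t, w, h1, h2⟩
    have h0 : (∏ i ∈ S, ζ i) ^ t ≠ 0 := pow_ne_zero _ (Finset.prod_ne_zero_iff.2 fun i _ => hζ i)
    refine ⟨((∏ i ∈ S, ζ i) ^ t)⁻¹ • w, ⟨t, ?_⟩, ?_⟩
    · rwa [smul_smul, mul_inv_cancel₀ h0, one_smul]
    · change C.diff w = _ at h2
      rw [map_smul, h2, smul_smul, inv_mul_cancel₀ h0, one_smul]
  · rintro ⟨w, ⟨t, h1⟩, rfl⟩
    exact ⟨t, _, h1, by simp⟩

/-- Exactness is known only in internal degrees ≥ 0, but multiplying by the product of the ζ i over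
a nonempty S raises the degree, so any cycle becomes a boundary after enough multiplications. -/
theorem loc_Z_eq_loc_B (q : ℕ) {S : Finset (Fin N)} (hS : 0 < S.card) (d : ℤ) :
    (C.Z (q + 1)).loc S d = (C.B q).loc S d := by
  refine le_antisymm ?_ ?_
  · rintro v ⟨t, ht⟩
    have h := (C.Z (q + 1)).prod_smul_mem_add S t d.natAbs d ht
    -- The degree d + (t + |d|) · #S is nonnegative because #S ≥ 1.
    refine ⟨t + d.natAbs, C.exact q _ _ ?_ h.1 h.2⟩
    have h1 : (1 : ℤ) ≤ S.card := by exact_mod_cast hS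
    have h2 : ((t + d.natAbs : ℕ) : ℤ) * 1 ≤ (t + d.natAbs : ℕ) * S.card :=
      mul_le_mul_of_nonneg_left h1 (Nat.cast_nonneg _)
    push_cast at h2 ⊢
    have := neg_abs_le d
    omega
  · rintro v ⟨t, ht⟩
    exact ⟨t, C.B_le_Z q _ ht⟩

theorem coch_Z_eq_coch_B (q : ℕ) {j : ℤ} (hj : 0 < j) (d : ℤ) :
    (C.Z (q + 1)).coch j d = (C.B q).coch j d := by
  ext α
  simp only [Fam.mem_coch]
  refine forall_congr' fun S => and_congr_left' (imp_congr_right fun hS => ?_)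
  rw [C.loc_Z_eq_loc_B q (by omega) d]

theorem coch_Z_le (hζ : ∀ i, ζ i ≠ 0) (q : ℕ) {j d : ℤ} {α : Finset (Fin N) → E}
    (hα : α ∈ (C.Z q).coch j d) :
    α ∈ (C.D q).coch j d := fun S =>
  ⟨fun h => ((C.mem_loc_Z hζ).1 ((hα S).1 h)).1, (hα S).2⟩

theorem diff_coch_Z (hζ : ∀ i, ζ i ≠ 0) (q : ℕ) {j d : ℤ} {α : Finset (Fin N) → E}
    (hα : α ∈ (C.Z q).coch j d)
    (S : Finset (Fin N)) : C.diff (α S) = 0 := by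
  by_cases h : (S.card : ℤ) = j
  · exact ((C.mem_loc_Z hζ).1 ((hα S).1 h)).2
  · rw [(hα S).2 h, map_zero]

theorem mem_coch_Z (hζ : ∀ i, ζ i ≠ 0) (q : ℕ) {j d : ℤ} {α : Finset (Fin N) → E}
    (hα : α ∈ (C.D q).coch j d)
    (h : ∀ S, C.diff (α S) = 0) : α ∈ (C.Z q).coch j d := fun S =>
  ⟨fun hS => (C.mem_loc_Z hζ).2 ⟨(hα S).1 hS, h S⟩, (hα S).2⟩

theorem diff_mem_coch_B (hζ : ∀ i, ζ i ≠ 0) (q : ℕ) {j d : ℤ} {α : Finset (Fin N) → E}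
    (hα : α ∈ (C.D q).coch j d) :
    (fun S => C.diff (α S)) ∈ (C.B q).coch j d := fun S =>
  ⟨fun hS => (C.mem_loc_B hζ).2 ⟨_, (hα S).1 hS, rfl⟩, fun hS => by simp [(hα S).2 hS]⟩

theorem exists_of_mem_coch_B (hζ : ∀ i, ζ i ≠ 0) (q : ℕ) {j d : ℤ} {α : Finset (Fin N) → E}
    (hα : α ∈ (C.B q).coch j d) :
    ∃ β ∈ (C.D q).coch j d, (fun S => C.diff (β S)) = α := by
  have : ∀ S, ∃ w, ((S.card : ℤ) = j → w ∈ (C.D q).loc S d) ∧ ((S.card : ℤ) ≠ j → w = 0) ∧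
      C.diff w = α S := by
    intro S
    by_cases hS : (S.card : ℤ) = j
    · obtain ⟨w, hw, h⟩ := (C.mem_loc_B hζ).1 ((hα S).1 hS)
      exact ⟨w, fun _ => hw, fun h => absurd hS h, h⟩
    · exact ⟨0, fun h => absurd h hS, fun _ => rfl, by rw [(hα S).2 hS, map_zero]⟩
  choose β h1 h2 h3 using this
  exact ⟨β, fun S => ⟨h1 S, h2 S⟩, funext h3⟩

theorem delta_diff (α : Finset (Fin N) → E) :
    delta k N E (fun S => C.diff (α S)) = fun S => C.diff (delta k N E α S) :=
  delta_comp (C.diff.restrictScalars k) α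

/-- `H^1` of the cocycles vanishes. -/
theorem hdim_Z_one (hζ : ∀ i, ζ i ≠ 0) (q : ℕ) (d : ℤ) (hN : 0 < N) : (C.Z q).hdim 1 d = 0 := by
  refine Subquot.dim_eq_zero fun α hα => ?_
  obtain ⟨hα, hδ⟩ := Fam.mem_cocyc.1 hα
  obtain ⟨β, hβ, rfl⟩ := (C.contractible q).cocyc_le_cobdy
    (Fam.mem_cocyc.2 ⟨C.coch_Z_le hζ q hα, hδ⟩)
  refine ⟨β, C.mem_coch_Z hζ q hβ fun S => ?_, rfl⟩
  -- The primitive β has Čech degree 0. Its image under the differential is a degree-zero Čech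
  -- cocycle, hence zero, so β already takes values in the cocycles.
  refine congrFun (eq_zero_of_delta_eq_zero (R := k) hN (α := fun S => C.diff (β S)) ?_ ?_) S
  · intro S hS
    rw [(hβ S).2 (by simpa using hS), map_zero]
  · rw [C.delta_diff]
    exact funext fun S => C.diff_coch_Z hζ q hα S

/-- The long exact sequence of 0 → Z_q → D_q → B_q → 0: the connecting map H^j(B_q) → H^{j+1}(Z_q)
is onto because D_q has no cohomology. It is encoded as the relation of all pairs (δβ, dβ) with β a
cochain of D_q. -/
theorem hdim_Z_le_hdim_B (hζ : ∀ i, ζ i ≠ 0) (q : ℕ) (j d : ℤ) : (C.Z q).hdim (j + 1) d ≤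
    (C.B q).hdim j d := by
  refine Subquot.dim_le_dim_of_rel _ _ _ _
    (((C.D q).coch j d).map (LinearMap.prod (delta k N E)
      ((C.diff.restrictScalars k).compLeft (Finset (Fin N))))) ?_ ?_
  · intro α hα
    obtain ⟨hα, hδ⟩ := Fam.mem_cocyc.1 hα
    obtain ⟨β, hβ, rfl⟩ := (C.contractible q).cocyc_le_cobdy
      (Fam.mem_cocyc.2 ⟨C.coch_Z_le hζ q hα, hδ⟩)
    rw [add_sub_cancel_right] at hβ
    refine ⟨fun S => C.diff (β S), Fam.mem_cocyc.2 ⟨C.diff_mem_coch_B hζ q hβ, ?_⟩,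
      β, hβ, rfl⟩
    rw [C.delta_diff]
    exact funext fun S => C.diff_coch_Z hζ q hα S
  · rintro α γ hα hγ ⟨β, hβ, h⟩ ⟨η, hη, hηγ⟩
    have h' : (fun S => C.diff (β S)) = γ := congrArg Prod.snd h
    have h : delta k N E β = α := congrArg Prod.fst h
    subst h
    obtain ⟨η', hη', rfl⟩ := C.exists_of_mem_coch_B hζ q hη
    have hγ' : (fun S => C.diff (β S)) = fun S => C.diff (delta k N E η' S) := by
      rw [← C.delta_diff, hηγ]; exact h'
    have hcob : delta k N E η' ∈ (C.D q).coch j d := (C.D q).delta_mem_coch hη'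
    -- If dβ is the coboundary of dη', correcting β by δη' makes it Z-valued and leaves its
    -- coboundary unchanged.
    refine ⟨β - delta k N E η', ?_, ?_⟩
    · rw [add_sub_cancel_right]
      refine C.mem_coch_Z hζ q (sub_mem hβ hcob) fun S => ?_
      rw [Pi.sub_apply, map_sub, congrFun hγ' S, sub_self]
    · rw [map_sub, delta_delta, sub_zero]

/-- For j ≥ 2 both the j-cochains and the (j-1)-cochains involve only nonempty S, where the two
localizations coincide. -/
theorem hdim_B_eq_hdim_Z (q : ℕ) {j : ℤ} (hj : 2 ≤ j) (d : ℤ) :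
    (C.B q).hdim j d = (C.Z (q + 1)).hdim j d := by
  unfold Fam.hdim Fam.cocyc Fam.cobdy
  rw [C.coch_Z_eq_coch_B q (by omega), C.coch_Z_eq_coch_B q (by omega)]

/-- In Čech degree 1 the cocycles of B_q and Z_{q+1} agree, but their degree-zero cochains live at S
= ∅, where nothing is inverted. The discrepancy is the homology of the complex in degree d. As
H^1(Z_{q+1}) = 0, every cocycle is δβ with β over Z_{q+1}, and it is related to β ∅. -/
theorem hdim_B_one_le (hζ : ∀ i, ζ i ≠ 0) (q : ℕ) (d : ℤ) (hN : 0 < N) :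
    (C.B q).hdim 1 d ≤ Subquot.dim ((C.Z (q + 1)).gr d) ((C.B q).gr d) := by
  refine Subquot.dim_le_dim_of_rel _ _ _ _
    (((C.Z (q + 1)).coch 0 d).map (LinearMap.prod (delta k N E) (LinearMap.proj ∅))) ?_ ?_
  · intro α hα
    obtain ⟨hα, hδ⟩ := Fam.mem_cocyc.1 hα
    rw [← C.coch_Z_eq_coch_B q one_pos] at hα
    obtain ⟨β, hβ, rfl⟩ := (C.contractible (q + 1)).cocyc_le_cobdy
      (Fam.mem_cocyc.2 ⟨C.coch_Z_le hζ _ hα, hδ⟩)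
    rw [sub_self] at hβ
    have hβ' : β ∈ (C.Z (q + 1)).coch 0 d := by
      refine C.mem_coch_Z hζ _ hβ (congrFun
        (eq_zero_of_delta_eq_zero (R := k) hN (α := fun S => C.diff (β S)) ?_ ?_))
      · intro S hS
        rw [(hβ S).2 (by simpa using hS), map_zero]
      · rw [C.delta_diff]
        exact funext fun S => C.diff_coch_Z hζ _ hα S
    refine ⟨β ∅, ?_, β, hβ', rfl⟩
    rw [← Fam.loc_empty]
    exact (hβ' ∅).1 rfl
  · rintro α y - - ⟨β, hβ, h⟩ hy
    have h' : β ∅ = y := congrArg Prod.snd h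
    have h : delta k N E β = α := congrArg Prod.fst h
    subst h h'
    refine ⟨β, fun S => ⟨fun hS => ?_, fun hS => ?_⟩, rfl⟩
    · rw [sub_self, Nat.cast_eq_zero, Finset.card_eq_zero] at hS
      subst hS
      rwa [Fam.loc_empty]
    · exact (hβ S).2 (by omega)

/-- Dimension shifting: each step trades one Čech degree for one step along the complex, until
H^1(B_{q+j}) is reached. -/
theorem hdim_Z_le (hζ : ∀ i, ζ i ≠ 0) (j q : ℕ) (d : ℤ) (hN : 0 < N) :
    (C.Z q).hdim (j + 2) d ≤
      Subquot.dim ((C.Z (q + j + 1)).gr d) ((C.B (q + j)).gr d) := by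
  induction j generalizing q with
  | zero =>
    exact (C.hdim_Z_le_hdim_B hζ q 1 d).trans (C.hdim_B_one_le hζ q d hN)
  | succ j ih =>
    have h := C.hdim_Z_le_hdim_B hζ q (j + 2) d
    rw [C.hdim_B_eq_hdim_Z q (by omega)] at h
    have h2 := ih (q + 1)
    have e : q + 1 + j = q + (j + 1) := by ring
    rw [e] at h2
    refine le_trans (le_of_eq ?_) (h.trans h2)
    push_cast
    ring_nf

end AcyclicComplex

end CechVec
end

noncomputable section

open AltSign CechVec

/-! ### Čech cohomology of a module contained in a field -/

namespace CechLocal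

variable {k A M K : Type u} [Field k] [CommRing A] [Algebra k A] [AddCommGroup M] [Module A M]
  [Module k M] [IsScalarTower k A M] [Field K] [Algebra A K] [Algebra k K] [IsScalarTower k A K]
  {N : ℕ} {z : Fin N → A} {ℳ : ℤ → Submodule k M}

/-- The images in `K` of the graded parts of `M`. -/
def imgFam (f : M →ₗ[A] K) (hℳ : ∀ i d w, w ∈ ℳ d → z i • w ∈ ℳ (d + 1)) :
    Fam k K (fun i => algebraMap A K (z i)) where
  gr d := (ℳ d).map (f.restrictScalars k)
  smul_mem' := by
    rintro i d _ ⟨w, hw, rfl⟩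
    exact ⟨z i • w, hℳ i d w hw, by simp [Algebra.smul_def]⟩

theorem algebraMap_prod_ne_zero (hz : ∀ i, algebraMap A K (z i) ≠ 0) (S : Finset (Fin N)) (t : ℕ) :
    algebraMap A K ((∏ i ∈ S, z i) ^ t) ≠ 0 := by
  rw [map_pow, map_prod]
  exact pow_ne_zero _ (Finset.prod_ne_zero_iff.2 fun i _ => hz i)

theorem isUnit_algebraMap_end (hz : ∀ i, algebraMap A K (z i) ≠ 0) (S : Finset (Fin N))
    (x : Submonoid.powers (∏ i ∈ S, z i)) : IsUnit (algebraMap A (Module.End A K) x) := by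
  obtain ⟨_, t, rfl⟩ := x
  have h := algebraMap_prod_ne_zero hz S t
  rw [Module.End.isUnit_iff]
  constructor
  · intro a b hab
    simp only [Module.algebraMap_end_apply, Algebra.smul_def] at hab
    exact mul_left_cancel₀ h hab
  · intro a
    refine ⟨(algebraMap A K ((∏ i ∈ S, z i) ^ t))⁻¹ * a, ?_⟩
    simp only [Module.algebraMap_end_apply, Algebra.smul_def]
    rw [← mul_assoc, mul_inv_cancel₀ h, one_mul]

/-- The map of the localization into `K`. -/
def locEmb (hz : ∀ i, algebraMap A K (z i) ≠ 0) (f : M →ₗ[A] K) (S : Finset (Fin N)) :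
    Loc z M S →ₗ[A] K :=
  LocalizedModule.lift _ f (isUnit_algebraMap_end hz S)

variable (hz : ∀ i, algebraMap A K (z i) ≠ 0) {f : M →ₗ[A] K} (hf : Function.Injective f)
  (hℳ : ∀ i d w, w ∈ ℳ d → z i • w ∈ ℳ (d + 1))

theorem locEmb_mk (S : Finset (Fin N)) (w : M) (t : ℕ) :
    algebraMap A K ((∏ i ∈ S, z i) ^ t) *
      locEmb hz f S (LocalizedModule.mk w (Submonoid.pow (∏ i ∈ S, z i) t)) = f w := by
  rw [← Algebra.smul_def, ← map_smul, LocalizedModule.smul'_mk]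
  have : LocalizedModule.mk ((∏ i ∈ S, z i) ^ t • w) (Submonoid.pow (∏ i ∈ S, z i) t) =
      LocalizedModule.mkLinearMap (Submonoid.powers (∏ i ∈ S, z i)) M w := by
    exact LocalizedModule.mk_cancel (Submonoid.pow (∏ i ∈ S, z i) t) w
  rw [this]
  exact LinearMap.congr_fun (LocalizedModule.lift_comp _ f (isUnit_algebraMap_end hz S)) w

theorem exists_mk (S : Finset (Fin N)) (x : Loc z M S) :
    ∃ (w : M) (t : ℕ), x = LocalizedModule.mk w (Submonoid.pow (∏ i ∈ S, z i) t) := by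
  induction x using LocalizedModule.induction_on with
  | h w s =>
    obtain ⟨_, t, rfl⟩ := s
    exact ⟨w, t, rfl⟩

theorem locEmb_injective (hf : Function.Injective f) (S : Finset (Fin N)) :
    Function.Injective (locEmb hz f S) := by
  rw [← LinearMap.ker_eq_bot, LinearMap.ker_eq_bot']
  intro x hx
  obtain ⟨w, t, rfl⟩ := exists_mk S x
  have h := locEmb_mk hz (f := f) S w t
  rw [hx, mul_zero] at h
  rw [hf (h.symm.trans (map_zero f).symm), LocalizedModule.zero_mk]

/-- Inside K all restriction maps become inclusions, which is what allows the Čech complex to be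
modelled by functions with values in one space. -/
theorem locEmb_restrict (S : Finset (Fin N)) (i : Fin N) (hi : i ∈ S) (x : Loc z M (S.erase i)) :
    locEmb hz f S (restrict z M S i hi x) = locEmb hz f (S.erase i) x := by
  have h : (locEmb hz f S ∘ₗ restrict z M S i hi) = locEmb hz f (S.erase i) := by
    refine IsLocalizedModule.ext (Submonoid.powers (∏ l ∈ S.erase i, z l))
      (LocalizedModule.mkLinearMap (Submonoid.powers (∏ l ∈ S.erase i, z l)) M)
      (isUnit_algebraMap_end hz _) ?_
    rw [LinearMap.comp_assoc, restrict, LocalizedModule.lift_comp, locEmb, locEmb,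
      LocalizedModule.lift_comp, LocalizedModule.lift_comp]
  exact LinearMap.congr_fun h x

theorem locEmb_mem_loc (S : Finset (Fin N)) (d : ℤ) (x : Loc z M S) :
    locEmb hz f S x ∈ (imgFam f hℳ).loc S d ↔ ∃ (t : ℕ) (w : M), w ∈ ℳ (d + t * S.card) ∧
      locEmb hz f S x = locEmb hz f S (LocalizedModule.mk w (Submonoid.pow (∏ i ∈ S, z i) t)) := by
  refine exists_congr fun t => ?_
  rw [← map_prod, ← map_pow, smul_eq_mul]
  have h0 := algebraMap_prod_ne_zero hz S t
  constructor
  · rintro ⟨w, hw, h⟩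
    refine ⟨w, hw, mul_left_cancel₀ h0 ?_⟩
    rw [locEmb_mk]
    exact h.symm
  · rintro ⟨w, hw, h⟩
    exact ⟨w, hw, by rw [h, locEmb_mk]; rfl⟩

theorem locEmb_mem_of_mem_locPiece (S : Finset (Fin N)) (d : ℤ) (x : Loc z M S)
    (hx : x ∈ locPiece k z ℳ S d) : locEmb hz f S x ∈ (imgFam f hℳ).loc S d := by
  have : locPiece k z ℳ S d ≤
      ((imgFam f hℳ).loc S d).comap ((locEmb hz f S).restrictScalars k) := by
    refine Submodule.span_le.2 ?_
    rintro x ⟨t, w, hw, rfl⟩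
    exact (locEmb_mem_loc hz hℳ S d _).2 ⟨t, w, hw, rfl⟩
  exact this hx

theorem mem_locPiece_of_locEmb_mem (hf : Function.Injective f) (S : Finset (Fin N)) (d : ℤ)
    (x : Loc z M S) (hx : locEmb hz f S x ∈ (imgFam f hℳ).loc S d) : x ∈ locPiece k z ℳ S d := by
  obtain ⟨t, w, hw, h⟩ := (locEmb_mem_loc hz hℳ S d x).1 hx
  exact Submodule.subset_span ⟨t, w, hw, locEmb_injective hz hf S h⟩

/-- The map from the Čech cochains of `M` to functions with values in `K`. -/
def cochEmb (hz : ∀ i, algebraMap A K (z i) ≠ 0) (f : M →ₗ[A] K) (j : ℕ) :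
    Cochain z M j →ₗ[A] (Finset (Fin N) → K) :=
  LinearMap.pi fun S => if h : S.card = j then locEmb hz f S ∘ₗ LinearMap.proj
    (⟨S, h⟩ : {S : Finset (Fin N) // S.card = j}) else 0

theorem cochEmb_apply {j : ℕ} (α : Cochain z M j) (S : {S : Finset (Fin N) // S.card = j}) :
    cochEmb hz f j α S.1 = locEmb hz f S.1 (α S) := by
  simp [cochEmb, S.2]

theorem cochEmb_apply_of_ne {j : ℕ} (α : Cochain z M j) {S : Finset (Fin N)} (h : S.card ≠ j) :
    cochEmb hz f j α S = 0 := by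
  simp [cochEmb, h]

theorem cochEmb_injective (hf : Function.Injective f) (j : ℕ) :
    Function.Injective (cochEmb hz f j) := by
  intro α β h
  funext S
  apply locEmb_injective hz hf
  rw [← cochEmb_apply, h, cochEmb_apply]

theorem diff_apply {j : ℕ} (α : Cochain z M j) (S : {S : Finset (Fin N) // S.card = j + 1}) :
    diff z M j α S = ∑ i : {i // i ∈ S.1}, ((-1 : A) ^ (S.1.filter (· < i.1)).card) •
      restrict z M S.1 i.1 i.2 (α ⟨S.1.erase i.1, by
        rw [Finset.card_erase_of_mem i.2, S.2]; rfl⟩) := by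
  simp [diff, LinearMap.sum_apply]

theorem cochEmb_diff {j : ℕ} (α : Cochain z M j) :
    cochEmb hz f (j + 1) (diff z M j α) = delta k N K (cochEmb hz f j α) := by
  funext S
  rw [delta_apply]
  by_cases hS : S.card = j + 1
  · rw [cochEmb_apply hz (diff z M j α) ⟨S, hS⟩, diff_apply, map_sum,
      ← Finset.sum_coe_sort S]
    refine Finset.sum_congr rfl fun i _ => ?_
    have hi : (S.erase i.1).card = j := by rw [Finset.card_erase_of_mem i.2, hS]; rfl
    rw [map_smul, locEmb_restrict, cochEmb_apply hz α ⟨S.erase i.1, hi⟩, Algebra.smul_def, sgn,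
      zsmul_eq_mul]
    simp
  · rw [cochEmb_apply_of_ne hz _ hS]
    refine (Finset.sum_eq_zero fun i hi => ?_).symm
    rw [cochEmb_apply_of_ne hz α, smul_zero]
    have := Finset.card_erase_add_one hi
    omega

theorem mem_cochainPiece_iff (hf : Function.Injective f) {j : ℕ} {d : ℤ} (α : Cochain z M j) :
    α ∈ cochainPiece k z ℳ j d ↔ cochEmb hz f j α ∈ (imgFam f hℳ).coch j d := by
  constructor
  · intro hα S
    refine ⟨fun hS => ?_, fun hS => cochEmb_apply_of_ne hz α (by exact_mod_cast hS)⟩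
    have hS : S.card = j := by exact_mod_cast hS
    rw [cochEmb_apply hz α ⟨S, hS⟩]
    exact locEmb_mem_of_mem_locPiece hz hℳ S d _ (hα ⟨S, hS⟩ trivial)
  · intro hα S _
    refine mem_locPiece_of_locEmb_mem hz hℳ hf _ d _ ?_
    rw [← cochEmb_apply]
    exact (hα S.1).1 (by exact_mod_cast S.2)

theorem exists_cochEmb_eq (hz : ∀ i, algebraMap A K (z i) ≠ 0)
    (hℳ : ∀ i d w, w ∈ ℳ d → z i • w ∈ ℳ (d + 1)) {j : ℕ} {d : ℤ} {β : Finset (Fin N) → K}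
    (hβ : β ∈ (imgFam f hℳ).coch j d) : ∃ α : Cochain z M j, cochEmb hz f j α = β := by
  have : ∀ S : {S : Finset (Fin N) // S.card = j}, ∃ x : Loc z M S.1, locEmb hz f S.1 x = β S := by
    rintro ⟨S, hS⟩
    obtain ⟨t, w, hw, h⟩ := (hβ S).1 (by exact_mod_cast hS)
    refine ⟨LocalizedModule.mk w (Submonoid.pow (∏ i ∈ S, z i) t),
      mul_left_cancel₀ (algebraMap_prod_ne_zero hz S t) ?_⟩
    rw [locEmb_mk, map_pow, map_prod]
    exact h
  choose α hα using this
  refine ⟨α, funext fun S => ?_⟩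
  by_cases hS : S.card = j
  · rw [cochEmb_apply hz α ⟨S, hS⟩, hα]
  · rw [cochEmb_apply_of_ne hz α hS, (hβ S).2 (by exact_mod_cast hS)]

/-- A class is related to the image in K of any homogeneous cocycle representing it. If that image
bounds in K, the primitive consists of genuine fractions of M, so it lifts and the class is zero. -/
theorem rank_HPiece_le (hz : ∀ i, algebraMap A K (z i) ≠ 0)
    (hℳ : ∀ i d w, w ∈ ℳ d → z i • w ∈ ℳ (d + 1))
    (hf : Function.Injective f) (j : ℕ) (d : ℤ) :
    Module.rank k (HPiece k z ℳ j d) ≤ (imgFam f hℳ).hdim j d := by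
  refine Subquot.rank_le_dim_of_rel _ _
    ((((cochainPiece k z ℳ j d).comap
      ((LinearMap.ker (diff z M j)).subtype.restrictScalars k)).map
      (LinearMap.prod
        (((coboundaries z M j).comap (LinearMap.ker (diff z M j)).subtype).mkQ.restrictScalars k)
        ((cochEmb hz f j).restrictScalars k ∘ₗ
          (LinearMap.ker (diff z M j)).subtype.restrictScalars k))).comap
      (LinearMap.prodMap (HPiece k z ℳ j d).subtype LinearMap.id)) ?_ ?_
  · rintro ⟨_, α, hα, rfl⟩
    refine ⟨cochEmb hz f j α, Fam.mem_cocyc.2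
      ⟨(mem_cochainPiece_iff hz hℳ hf _).1 hα, ?_⟩, α, hα, rfl⟩
    rw [← cochEmb_diff, show diff z M j α = 0 from α.2, map_zero]
  · rintro ⟨x, hx⟩ y - ⟨α, hα, h⟩ hy
    have h1 : cochEmb hz f j α = y := congrArg Prod.snd h
    have h2 : ((coboundaries z M j).comap (LinearMap.ker (diff z M j)).subtype).mkQ α = x :=
      congrArg Prod.fst h
    subst h1 h2
    refine Subtype.ext ((Submodule.Quotient.mk_eq_zero _).2 ?_)
    obtain ⟨η, hη, h⟩ := hy
    change (α : Cochain z M j) ∈ coboundaries z M j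
    cases j with
    | zero =>
      -- There are no cochains in degree -1.
      have : η = 0 := by
        funext S
        exact (hη S).2 (by have := S.card.cast_nonneg (α := ℤ); push_cast; omega)
      rw [this, map_zero] at h
      rw [cochEmb_injective hz hf 0 (h.symm.trans (map_zero _).symm)]
      exact zero_mem _
    | succ j =>
      rw [Nat.cast_succ, add_sub_cancel_right] at hη
      obtain ⟨η, rfl⟩ := exists_cochEmb_eq hz hℳ hη
      rw [← cochEmb_diff] at h
      exact ⟨η, cochEmb_injective hz hf _ h⟩

theorem rank_HPiece_zero (hz : ∀ i, algebraMap A K (z i) ≠ 0)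
    (hℳ : ∀ i d w, w ∈ ℳ d → z i • w ∈ ℳ (d + 1))
    (hf : Function.Injective f) (hN : 0 < N) (d : ℤ) :
    Module.rank k (HPiece k z ℳ 0 d) = 0 := by
  refine le_antisymm ((rank_HPiece_le hz hℳ hf 0 d).trans_eq ?_) (zero_le)
  refine Subquot.dim_eq_zero fun α hα => ?_
  obtain ⟨hα, hδ⟩ := Fam.mem_cocyc.1 hα
  rw [eq_zero_of_delta_eq_zero hN (fun S hS => (hα S).2 (by simpa using hS)) hδ]
  exact zero_mem _

/-! ### The homogeneous parts span the cohomology -/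

/-- Projections of `M` onto its graded parts. -/
structure GradedProj (ℳ : ℤ → Submodule k M) where
  /-- The projection onto the degree `d` part. -/
  π : ℤ → M →ₗ[k] M
  mem : ∀ d w, π d w ∈ ℳ d
  self : ∀ d w, w ∈ ℳ d → π d w = w
  ne : ∀ d e w, w ∈ ℳ e → d ≠ e → π d w = 0
  exists_sum : ∀ w, ∃ F : Finset ℤ, ∑ d ∈ F, π d w = w

theorem GradedProj.eq_zero_of_sum (P : GradedProj ℳ) (F : Finset ℤ) (s : ℤ) (v : ℤ → M)
    (hv : ∀ d ∈ F, v d ∈ ℳ (d + s)) (h : ∑ d ∈ F, v d = 0) : ∀ d ∈ F, v d = 0 := by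
  intro d hd
  have := congrArg (P.π (d + s)) h
  rwa [map_sum, map_zero, Finset.sum_eq_single_of_mem d hd, P.self _ _ (hv d hd)] at this
  intro e he hed
  exact P.ne _ _ _ (hv e he) (by omega)

/-- The graded pieces of a localization are independent: a common denominator reduces a relation
among them to one in M, where the projections separate degrees. -/
theorem locPiece_eq_zero_of_sum (hz : ∀ i, algebraMap A K (z i) ≠ 0)
    (hℳ : ∀ i d w, w ∈ ℳ d → z i • w ∈ ℳ (d + 1))
    (P : GradedProj ℳ) (hf : Function.Injective f)
    (S : Finset (Fin N)) (F : Finset ℤ) (x : ℤ → Loc z M S)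
    (hx : ∀ d ∈ F, x d ∈ locPiece k z ℳ S d) (h : ∑ d ∈ F, x d = 0) : ∀ d ∈ F, x d = 0 := by
  have hx' : ∀ d, ∃ t : ℕ, d ∈ F → (∏ i ∈ S, algebraMap A K (z i)) ^ t • locEmb hz f S (x d) ∈
      (imgFam f hℳ).gr (d + t * S.card) := by
    intro d
    by_cases hd : d ∈ F
    · obtain ⟨t, ht⟩ := locEmb_mem_of_mem_locPiece hz hℳ S d _ (hx d hd)
      exact ⟨t, fun _ => ht⟩
    · exact ⟨0, fun h => absurd h hd⟩
  choose t ht using hx'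
  set T := ∑ d ∈ F, t d with hT
  have hw : ∀ d, ∃ w : M, d ∈ F → w ∈ ℳ (d + T * S.card) ∧
      f w = (∏ i ∈ S, algebraMap A K (z i)) ^ T • locEmb hz f S (x d) := by
    intro d
    by_cases hd : d ∈ F
    · obtain ⟨r, hr⟩ := Nat.exists_eq_add_of_le
        (Finset.single_le_sum (fun d _ => Nat.zero_le (t d)) hd)
      obtain ⟨w, hw, h⟩ := (imgFam f hℳ).prod_smul_mem_add S (t d) r d (ht d hd)
      rw [← hr] at hw h
      exact ⟨w, fun _ => ⟨hw, h⟩⟩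
    · exact ⟨0, fun h => absurd h hd⟩
  choose w hw using hw
  have hsum : ∑ d ∈ F, w d = 0 := by
    apply hf
    rw [map_sum, map_zero, Finset.sum_congr rfl fun d hd => (hw d hd).2, ← Finset.smul_sum,
      ← map_sum, h, map_zero, smul_zero]
  intro d hd
  have h1 := P.eq_zero_of_sum F _ w (fun d hd => (hw d hd).1) hsum d hd
  have h2 := (hw d hd).2
  rw [h1, map_zero] at h2
  refine locEmb_injective hz hf S (Eq.trans ?_ (map_zero _).symm)
  exact (smul_eq_zero.1 h2.symm).resolve_left
    (pow_ne_zero _ (Finset.prod_ne_zero_iff.2 fun i _ => hz i))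

theorem exists_locPiece_sum (P : GradedProj ℳ) (S : Finset (Fin N)) (x : Loc z M S) :
    ∃ (F : Finset ℤ) (c : ℤ → Loc z M S), (∀ d, c d ∈ locPiece k z ℳ S d) ∧
      (∀ d ∉ F, c d = 0) ∧ ∑ d ∈ F, c d = x := by
  classical
  obtain ⟨w, t, rfl⟩ := exists_mk S x
  obtain ⟨F, hF⟩ := P.exists_sum w
  set e : ℤ := t * S.card
  let g : M →+ Loc z M S :=
    { toFun := fun w => LocalizedModule.mk w (Submonoid.pow (∏ i ∈ S, z i) t)
      map_zero' := LocalizedModule.zero_mk _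
      map_add' := fun a b => by
        rw [LocalizedModule.mk_add_mk, ← smul_add, LocalizedModule.mk_cancel_common_left] }
  -- The numerator of a fraction of degree d has degree d + e. The value is set to 0 outside the
  -- finite set so that components at different S can later be summed over one common set.
  refine ⟨F.image (· - e), fun d => if d ∈ F.image (· - e) then g (P.π (d + e) w) else 0,
    fun d => ?_, fun d hd => if_neg hd, ?_⟩
  · dsimp only
    split_ifs
    · exact Submodule.subset_span ⟨t, _, P.mem _ _, rfl⟩
    · exact zero_mem _
  · rw [Finset.sum_congr rfl fun d hd => if_pos hd, Finset.sum_image (by simp)]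
    simp only [sub_add_cancel]
    rw [← map_sum, hF]
    rfl

/-- The differential preserves the internal degree and homogeneous pieces are independent, so the
homogeneous components of a cocycle are cocycles. -/
theorem iSup_HPiece_eq_top (P : GradedProj ℳ) (hz : ∀ i, algebraMap A K (z i) ≠ 0) {f : M →ₗ[A] K}
    (hf : Function.Injective f) (hℳ : ∀ i d w, w ∈ ℳ d → z i • w ∈ ℳ (d + 1)) (j : ℕ) :
    ⨆ d, HPiece k z ℳ j d = ⊤ := by
  classical
  rw [eq_top_iff]
  rintro x -
  obtain ⟨α, rfl⟩ := Submodule.mkQ_surjective _ x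
  have := fun S : {S : Finset (Fin N) // S.card = j} => exists_locPiece_sum P S.1 (α.1 S)
  choose F c hc hcF hsum using this
  set G := Finset.univ.biUnion F
  let a : ℤ → Cochain z M j := fun d S => c S d
  have ha : ∀ d, a d ∈ cochainPiece k z ℳ j d := fun d S _ => hc S d
  have hα : ∑ d ∈ G, a d = α.1 := by
    funext S
    rw [Finset.sum_apply, ← hsum S]
    refine (Finset.sum_subset (Finset.subset_biUnion_of_mem F (Finset.mem_univ S))
      fun d _ hd => hcF S d hd).symm
  have hdiff : ∀ d ∈ G, diff z M j (a d) = 0 := by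
    have h0 : ∑ d ∈ G, diff z M j (a d) = 0 := by rw [← map_sum, hα]; exact α.2
    intro d hd
    funext S
    refine locPiece_eq_zero_of_sum hz hℳ P hf S.1 G (fun d => diff z M j (a d) S)
      (fun d _ => ?_) (by simpa using congrFun h0 S) d hd
    have h1 : diff z M j (a d) ∈ cochainPiece k z ℳ (j + 1) d := by
      rw [mem_cochainPiece_iff hz hℳ hf, cochEmb_diff (k := k)]
      apply Fam.delta_mem_coch
      rw [Nat.cast_succ, add_sub_cancel_right, ← mem_cochainPiece_iff hz hℳ hf]
      exact ha d
    exact h1 S trivial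
  have hα' : α = ∑ d ∈ G.attach, (⟨a d.1, hdiff d.1 d.2⟩ : LinearMap.ker (diff z M j)) := by
    refine Subtype.ext ?_
    rw [← hα, ← Finset.sum_attach]
    simp
  rw [hα', map_sum]
  refine Submodule.sum_mem _ fun d _ => ?_
  refine Submodule.mem_iSup_of_mem d.1 ⟨_, ha d.1, rfl⟩

/-- An embedding of the graded module `M` into the field `K` under which the `z i` become
invertible. -/
structure FieldEmbedding (K : Type u) [Field K] [Algebra A K] [Algebra k K] [IsScalarTower k A K]
    (z : Fin N → A) (ℳ : ℤ → Submodule k M) where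
  /-- The underlying linear map. -/
  map : M →ₗ[A] K
  injective : Function.Injective map
  ne_zero : ∀ i, algebraMap A K (z i) ≠ 0
  smul_mem : ∀ i d w, w ∈ ℳ d → z i • w ∈ ℳ (d + 1)

namespace FieldEmbedding

variable (E : FieldEmbedding K z ℳ)

/-- The images in `K` of the graded parts of `M`. -/
abbrev fam : Fam k K (fun i => algebraMap A K (z i)) := imgFam E.map E.smul_mem

theorem rank_le (j : ℕ) (d : ℤ) : Module.rank k (HPiece k z ℳ j d) ≤ E.fam.hdim j d :=
  rank_HPiece_le E.ne_zero E.smul_mem E.injective j d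

theorem rank_zero (E : FieldEmbedding K z ℳ) (hN : 0 < N) (d : ℤ) : Module.rank k
    (HPiece k z ℳ 0 d) = 0 :=
  rank_HPiece_zero E.ne_zero E.smul_mem E.injective hN d

theorem iSup_eq_top (E : FieldEmbedding K z ℳ) (P : GradedProj ℳ) (j : ℕ) :
    ⨆ d, HPiece k z ℳ j d = ⊤ :=
  iSup_HPiece_eq_top P E.ne_zero E.injective E.smul_mem j

end FieldEmbedding

end CechLocal
end

noncomputable section

open AltSign

/-! ### The product of the two-term Čech complexes of `n` pairs of variables -/

namespace PairCech

/-- For each of the `n` pairs of variables, the variables that are inverted: both of them (`none`)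
or just one. -/
abbrev Ix (n : ℕ) : Type := Fin n → Option (Fin 2)

variable {n : ℕ}

/-- The pairs of which both variables are inverted. -/
def both (τ : Ix n) : Finset (Fin n) := Finset.univ.filter fun i => τ i = none

theorem mem_both {τ : Ix n} {i : Fin n} : i ∈ both τ ↔ τ i = none := by simp [both]

theorem both_update_some (τ : Ix n) (i : Fin n) (b : Fin 2) :
    both (Function.update τ i (some b)) = (both τ).erase i := by
  ext l
  by_cases h : l = i
  · subst h; simp [mem_both]
  · simp [mem_both, h]

theorem both_update_none (τ : Ix n) (i : Fin n) :
    both (Function.update τ i none) = insert i (both τ) := by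
  ext l
  by_cases h : l = i
  · subst h; simp [mem_both]
  · simp [mem_both, h]

section diff

variable (R : Type*) [Ring R] {X : Type*} [AddCommGroup X] [Module R X]

/-- The difference of the two values obtained by inverting just one variable of the pair `i`. -/
def edge (α : Ix n → X) (τ : Ix n) (i : Fin n) : X :=
  α (Function.update τ i (some 1)) - α (Function.update τ i (some 0))

/-- The differential. -/
def diff (n : ℕ) (X : Type*) [AddCommGroup X] [Module R X] : (Ix n → X) →ₗ[R] (Ix n → X) :=
  LinearMap.pi fun τ => ∑ i ∈ both τ, sgn (both τ) i •
    ((LinearMap.proj (Function.update τ i (some 1)) : (Ix n → X) →ₗ[R] X) -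
      LinearMap.proj (Function.update τ i (some 0)))

theorem diff_apply (α : Ix n → X) (τ : Ix n) :
    diff R n X α τ = ∑ i ∈ both τ, sgn (both τ) i • edge α τ i := by
  simp [diff, edge, LinearMap.sum_apply]

theorem diff_comp {Y : Type*} [AddCommGroup Y] [Module R Y] (f : X →+ Y) (α : Ix n → X) :
    diff R n Y (fun τ => f (α τ)) = fun τ => f (diff R n X α τ) := by
  funext τ
  simp [diff_apply, edge]

theorem diff_diff (α : Ix n → X) : diff R n X (diff R n X α) = 0 := by
  funext τ
  have h : ∀ i l, i ≠ l → edge (fun τ => edge α τ l) τ i = edge (fun τ => edge α τ i) τ l := by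
    intro i l hil
    simp only [edge, Function.update_comm hil]
    abel
  rw [Pi.zero_apply, ← sum_sgn_sgn_eq_zero (both τ) (fun i l => edge (fun τ => edge α τ l) τ i) h,
    diff_apply]
  refine Finset.sum_congr rfl fun i _ => ?_
  simp only [edge, diff_apply, both_update_some, ← Finset.sum_sub_distrib, ← smul_sub]

end diff

/-! ### Homotopies of the pair complex and its cohomology in one multidegree -/

section homotopy

variable {X : Type*} [AddCommGroup X]

/-- The sign `1` for `b = 1` and `-1` for `b = 0`. -/
def eps (b : Fin 2) : ℤ := if b = 1 then 1 else -1

theorem eps_mul_self (b : Fin 2) : eps b * eps b = 1 := by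
  unfold eps; split_ifs <;> simp

/-- The homotopy at the pair `i`. -/
def homotopy (i : Fin n) (b : Fin 2) (α : Ix n → X) : Ix n → X := fun τ =>
  if τ i = some b then (eps b * sgn (both τ) i) • α (Function.update τ i none) else 0

/-- The operator homotopic to the identity that evaluates at the other variable of the pair. -/
def collapse (i : Fin n) (b : Fin 2) (α : Ix n → X) : Ix n → X := fun τ =>
  if τ i = none then 0 else α (Function.update τ i (some (1 - b)))

theorem edge_self (α : Ix n → X) (τ : Ix n) (i : Fin n) (b : Fin 2) :
    edge α τ i = eps b • (α (Function.update τ i (some b)) -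
      α (Function.update τ i (some (1 - b)))) := by
  fin_cases b <;> simp [edge, eps]

variable (R : Type*) [Ring R] [Module R X]

/-- In the tensor factor of the pair i, the identity is homotopic to evaluation at the variable
other than b. If τ i is `none`, only the i-th summand of the differential contributes; if τ i is
`some b`, the cocycle condition at the index with both variables inverted is used; at the other
variable `collapse` does nothing and the homotopy term vanishes. -/
theorem eq_collapse_add_diff_homotopy (i : Fin n) (b : Fin 2) (α : Ix n → X)
    (hα : diff R n X α = 0) : α = collapse i b α + diff R n X (homotopy i b α) := by
  funext τ
  rw [Pi.add_apply, diff_apply]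
  rcases hτ : τ i with _ | c
  · have hi : i ∈ both τ := mem_both.2 hτ
    rw [Finset.sum_eq_single_of_mem i hi]
    · have hb : (1 - b) ≠ b := by fin_cases b <;> decide
      rw [edge_self _ _ _ b]
      simp only [collapse, hτ, homotopy, Function.update_self, if_true, both_update_some,
        sgn_erase_self, Option.some.injEq, hb, if_false, sub_zero, zero_add, smul_smul,
        Function.update_idem]
      rw [show sgn (both τ) i * (eps b * (eps b * sgn (both τ) i)) = 1 by
        linear_combination (sgn (both τ) i * sgn (both τ) i) * eps_mul_self b +
          sgn_mul_self (both τ) i, one_smul, ← hτ, Function.update_eq_self]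
    · intro l _ hl
      simp [edge, homotopy, Function.update_of_ne hl.symm, hτ]
  · have hi : i ∉ both τ := by simp [mem_both, hτ]
    by_cases hc : c = b
    · subst hc
      have h := congrFun hα (Function.update τ i none)
      rw [diff_apply, both_update_none, Finset.sum_insert hi, sgn_insert_self, Pi.zero_apply,
        edge_self _ _ _ c, Function.update_idem, Function.update_idem, ← hτ,
        Function.update_eq_self] at h
      have h' := congrArg (fun x => (eps c * sgn (both τ) i) • x) h
      simp only [smul_add, smul_smul, smul_zero, Finset.smul_sum] at h'
      rw [show eps c * sgn (both τ) i * (sgn (both τ) i * eps c) = 1 by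
        linear_combination (sgn (both τ) i * sgn (both τ) i) * eps_mul_self c +
          sgn_mul_self (both τ) i, one_smul] at h'
      have h2 : collapse i c α τ = α (Function.update τ i (some (1 - c))) := by
        simp [collapse, hτ]
      rw [h2, ← sub_eq_iff_eq_add', eq_neg_of_add_eq_zero_left h', ← Finset.sum_neg_distrib]
      refine Finset.sum_congr rfl fun l hl => ?_
      have hil : i ≠ l := fun h => hi (h ▸ hl)
      have hs := sgn_swap' (Finset.mem_insert_self i (both τ)) (Finset.mem_insert_of_mem hl) hil
      rw [Finset.erase_insert hi, sgn_insert_self, Finset.erase_insert_of_ne hil,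
        sgn_insert_self] at hs
      have hh : edge (homotopy i c α) τ l = (eps c * sgn ((both τ).erase l) i) •
          edge α (Function.update τ i none) l := by
        simp only [edge, homotopy, Function.update_of_ne hil, hτ, if_true, both_update_some,
          Function.update_comm hil, smul_sub]
      rw [hh, smul_smul, ← neg_smul]
      congr 1
      linear_combination -eps c * hs
    · have hc' : c = 1 - b := by fin_cases b <;> fin_cases c <;> simp_all
      rw [Finset.sum_eq_zero]
      · rw [add_zero]
        simp only [collapse, hτ, reduceCtorEq, if_false]
        rw [← hc', ← hτ, Function.update_eq_self]
      · intro l hl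
        have hil : i ≠ l := fun h => hi (h ▸ hl)
        simp [edge, homotopy, Function.update_of_ne hil, hτ, hc]

theorem collapse_diff (i : Fin n) (b : Fin 2) (α : Ix n → X) :
    collapse i b (diff R n X α) = diff R n X (collapse i b α) := by
  funext τ
  simp only [collapse, diff_apply]
  rcases hτ : τ i with _ | c
  · rw [if_pos rfl]
    refine (Finset.sum_eq_zero fun l _ => ?_).symm
    by_cases hil : i = l
    · subst hil
      simp [edge, collapse]
    · simp [edge, collapse, Function.update_of_ne hil, hτ]
  · have hi : i ∉ both τ := by simp [mem_both, hτ]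
    rw [if_neg (by simp), both_update_some, Finset.erase_eq_of_notMem hi]
    refine Finset.sum_congr rfl fun l hl => ?_
    have hil : i ≠ l := fun h => hi (h ▸ hl)
    simp [edge, collapse, Function.update_of_ne hil, hτ, Function.update_comm hil]

/-- Functions concentrated in cohomological degree `l`, vanishing where a variable
that satisfies `neg` is not inverted. -/
def Supp (neg : Fin n → Fin 2 → Prop) (l : ℕ) (α : Ix n → X) : Prop :=
  ∀ τ, α τ ≠ 0 → (both τ).card = l ∧ ∀ i b, neg i b → τ i = none ∨ τ i = some b

variable {neg : Fin n → Fin 2 → Prop} {l : ℕ}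

theorem Supp.add {α β : Ix n → X} (hα : Supp neg l α) (hβ : Supp neg l β) :
    Supp neg l (α + β) := by
  intro τ h
  by_cases h1 : α τ = 0
  · refine hβ τ fun h2 => h ?_
    rw [Pi.add_apply, h1, h2, add_zero]
  · exact hα τ h1

theorem Supp.collapse {α : Ix n → X} (hα : Supp neg l α) {i : Fin n} {b : Fin 2}
    (hb : ¬ neg i (1 - b)) : Supp neg l (collapse i b α) := by
  intro τ h
  unfold PairCech.collapse at h
  split_ifs at h with hτ
  · exact absurd rfl h
  · obtain ⟨h1, h2⟩ := hα _ h
    rw [both_update_some, Finset.erase_eq_of_notMem (by simpa [mem_both] using hτ)] at h1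
    refine ⟨h1, fun i' c hc => ?_⟩
    by_cases hi : i' = i
    · subst hi
      have := h2 _ _ hc
      simp only [Function.update_self, reduceCtorEq, Option.some.injEq, false_or] at this
      exact absurd (this ▸ hc) hb
    · simpa [hi] using h2 _ _ hc

/-- A value is moved from an index with both variables inverted to one where 1 - b is not inverted.
This respects supports precisely because the exponent of that variable is not negative. -/
theorem Supp.homotopy {α : Ix n → X} (hα : Supp neg (l + 1) α) {i : Fin n} {b : Fin 2}
    (hb : ¬ neg i (1 - b)) : Supp neg l (homotopy i b α) := by
  intro τ h
  unfold PairCech.homotopy at h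
  split_ifs at h with hτ
  · obtain ⟨h1, h2⟩ := hα _ (fun h0 => h (by rw [h0, smul_zero]))
    rw [both_update_none, Finset.card_insert_of_notMem (by simp [mem_both, hτ])] at h1
    refine ⟨by omega, fun i' c hc => ?_⟩
    by_cases hi : i' = i
    · subst hi
      by_cases hcb : c = b
      · subst hcb; exact Or.inr hτ
      · have hc' : c = 1 - b := by
          revert hcb; fin_cases b <;> fin_cases c <;> decide
        exact absurd (hc' ▸ hc) hb
    · simpa [hi] using h2 _ _ hc
  · exact absurd rfl h

/-- The composition of the operators `collapse i (b i)` for `i ∈ s`. -/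
def collapseAll (s : Finset (Fin n)) (b : Fin n → Fin 2) (α : Ix n → X) : Ix n → X := fun τ =>
  if ∃ i ∈ s, τ i = none then 0 else α fun i => if i ∈ s then some (1 - b i) else τ i

theorem collapse_collapseAll {s : Finset (Fin n)} {i : Fin n} (hi : i ∉ s) (b : Fin n → Fin 2)
    (α : Ix n → X) :
    collapse i (b i) (collapseAll s b α) = collapseAll (insert i s) b α := by
  funext τ
  simp only [collapse, collapseAll]
  by_cases hτ : τ i = none
  · rw [if_pos hτ, if_pos ⟨i, Finset.mem_insert_self _ _, hτ⟩]
  · rw [if_neg hτ]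
    have h1 : (∃ l ∈ s, Function.update τ i (some (1 - b i)) l = none) ↔
        ∃ l ∈ insert i s, τ l = none := by
      simp only [Finset.mem_insert, exists_eq_or_imp, hτ, false_or]
      refine exists_congr fun l => and_congr_right fun hl => ?_
      rw [Function.update_of_ne]
      rintro rfl
      exact hi hl
    simp only [h1]
    congr 2
    funext l
    by_cases hl : l = i
    · subst hl; simp [hi]
    · simp [hl]

theorem exists_eq_collapseAll_add_diff {α : Ix n → X} (hα : Supp neg (l + 1) α)
    (hd : diff R n X α = 0) (b : Fin n → Fin 2) (s : Finset (Fin n))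
    (hs : ∀ i ∈ s, ¬ neg i (1 - b i)) :
    ∃ β, Supp neg l β ∧ α = collapseAll s b α + diff R n X β := by
  induction s using Finset.induction_on with
  | empty => exact ⟨0, fun τ h => absurd rfl h, by funext τ; simp [collapseAll]⟩
  | insert i s hi ih =>
    obtain ⟨β, hβ, h⟩ := ih fun i hi => hs i (Finset.mem_insert_of_mem hi)
    have hb := hs i (Finset.mem_insert_self _ _)
    -- Collapsing α = collapseAll + dβ at one more pair keeps the second term exact, because
    -- `collapse` commutes with the differential.
    refine ⟨collapse i (b i) β + homotopy i (b i) α, (hβ.collapse hb).add (hα.homotopy hb), ?_⟩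
    have h1 := eq_collapse_add_diff_homotopy R i (b i) α hd
    have h2 : collapse i (b i) α = collapse i (b i) (collapseAll s b α) +
        collapse i (b i) (diff R n X β) := by
      conv_lhs => rw [h]
      funext τ
      simp only [collapse, Pi.add_apply]
      split_ifs <;> simp
    rw [collapse_collapseAll hi, collapse_diff] at h2
    rw [map_add, ← add_assoc, ← h2]
    exact h1

/-- The pairs with both variables satisfying `neg`. -/
def full (neg : Fin n → Fin 2 → Prop) [∀ i b, Decidable (neg i b)] : Finset (Fin n) :=
  Finset.univ.filter fun i => neg i 0 ∧ neg i 1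

/-- The index at which cocycles concentrated in the degree `#(full neg)` are evaluated. -/
def basePt (neg : Fin n → Fin 2 → Prop) [∀ i b, Decidable (neg i b)] : Ix n := fun i =>
  if neg i 0 ∧ neg i 1 then none else if neg i 0 then some 1 else some 0

/-- Künneth in a single multidegree. A pair contributes one-dimensional cohomology in degree 1 if
both exponents are negative, in degree 0 if neither is, and nothing if the signs differ. After
collapsing all pairs that are not fully negative, a cocycle is determined by its value at `basePt
neg`. -/
theorem exists_diff_eq [∀ i b, Decidable (neg i b)] {α : Ix n → X} (hα : Supp neg (l + 1) α)
    (hd : diff R n X α = 0) (h0 : α (basePt neg) = 0) :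
    ∃ β, Supp neg l β ∧ diff R n X β = α := by
  obtain ⟨β, hβ, h⟩ := exists_eq_collapseAll_add_diff R hα hd
    -- The index b is chosen so that 1 - b is a variable with nonnegative exponent, as the support
    -- conditions require; it exists because the pair is not fully negative.
    (fun i => if neg i 0 then 0 else 1) (Finset.univ.filter fun i => ¬ (neg i 0 ∧ neg i 1)) (by
      intro i hi
      rw [Finset.mem_filter] at hi
      split_ifs with h
      · exact fun h' => hi.2 ⟨h, h'⟩
      · exact h)
  refine ⟨β, hβ, ?_⟩
  rw [eq_comm, h]
  convert zero_add _
  funext τ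
  unfold collapseAll
  split_ifs with hτ
  · rfl
  · by_contra hne
    obtain ⟨_, h2⟩ := hα _ hne
    refine hne (Eq.trans (congrArg α ?_) h0)
    -- At fully negative pairs a nonzero value forces both variables to be inverted; at the others
    -- the collapsed index is by construction the base point.
    funext i
    by_cases hi : neg i 0 ∧ neg i 1
    · have h3 := h2 i 0 hi.1
      have h4 := h2 i 1 hi.2
      simp only [Finset.mem_filter, Finset.mem_univ, true_and, hi, not_true, and_self,
        if_false] at h3 h4
      simp only [basePt, Finset.mem_filter, Finset.mem_univ, true_and, hi, not_true, and_self,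
        if_false, if_true]
      rcases h3 with h3 | h3
      · exact h3
      · rw [h3] at h4; simp at h4
    · simp only [basePt, Finset.mem_filter, Finset.mem_univ, true_and, hi, not_false_iff, if_true,
        if_false]
      split_ifs <;> simp

end homotopy

end PairCech
end

noncomputable section

open AltSign CechVec PairCech

/-! ### Laurent polynomials -/

namespace Segre

variable {k : Type u} [Field k] {n : ℕ}

/-- The ring of Laurent polynomials in the `x_i` and `y_i`. -/
abbrev Laurent (k : Type u) [Field k] (n : ℕ) : Type u := AddMonoidAlgebra k (Fin n × Fin 2 → ℤ)

/-- The field of rational functions. -/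
def Frac (k : Type u) [Field k] (n : ℕ) : Type u := FractionRing (Laurent k n)

instance instFieldFrac : Field (Frac k n) := inferInstanceAs (Field (FractionRing (Laurent k n)))

instance instAlgebraLaurentFrac : Algebra (Laurent k n) (Frac k n) :=
  inferInstanceAs (Algebra (Laurent k n) (FractionRing (Laurent k n)))

instance instIsFractionRingFrac : IsFractionRing (Laurent k n) (Frac k n) :=
  inferInstanceAs (IsFractionRing (Laurent k n) (FractionRing (Laurent k n)))

instance instAlgebraBaseFrac : Algebra k (Frac k n) :=
  ((algebraMap (Laurent k n) (Frac k n)).comp (algebraMap k (Laurent k n))).toAlgebra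

instance instTowerLaurentFrac : IsScalarTower k (Laurent k n) (Frac k n) :=
  IsScalarTower.of_algebraMap_eq fun _ => rfl

/-- The inclusion of the exponents of monomials into those of Laurent monomials. -/
def castExp (n : ℕ) : (Fin n × Fin 2 →₀ ℕ) →+ (Fin n × Fin 2 → ℤ) where
  toFun m v := m v
  map_zero' := by funext; simp
  map_add' _ _ := by funext; simp

theorem castExp_injective : Function.Injective (castExp n) := by
  intro m m' h
  ext v
  exact Nat.cast_injective (R := ℤ) (congrFun h v)

/-- The inclusion of the polynomials into the Laurent polynomials. -/
def toLaurent (k : Type u) [Field k] (n : ℕ) : Poly k n →ₐ[k] Laurent k n :=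
  AddMonoidAlgebra.mapDomainAlgHom k k (castExp n)

theorem toLaurent_injective : Function.Injective (toLaurent k n) :=
  AddMonoidAlgebra.mapDomain_injective castExp_injective

/-- The inclusion of the Laurent polynomials into the rational functions. -/
def toFrac (k : Type u) [Field k] (n : ℕ) : Laurent k n →ₐ[k] Frac k n :=
  IsScalarTower.toAlgHom k _ _

theorem toFrac_injective : Function.Injective (toFrac k n) :=
  IsFractionRing.injective (Laurent k n) (Frac k n)

/-- The exponents in degree `d` of the Laurent monomials in which only the variables satisfying
`inv` are inverted. -/
def expSet (inv : Fin n × Fin 2 → Prop) (a : Fin n → ℤ) (d : ℤ) : Set (Fin n × Fin 2 → ℤ) :=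
  {m | (∀ v, ¬ inv v → 0 ≤ m v) ∧ ∀ i, m (i, 0) + m (i, 1) = d + a i}

/-- The Laurent polynomials with exponents in `expSet inv a d`. -/
def lPiece (k : Type u) [Field k] (inv : Fin n × Fin 2 → Prop) (a : Fin n → ℤ) (d : ℤ) :
    Submodule k (Laurent k n) :=
  AddMonoidAlgebra.supported k k (expSet inv a d)

theorem mem_lPiece {inv : Fin n × Fin 2 → Prop} {a : Fin n → ℤ} {d : ℤ} {f : Laurent k n} :
    f ∈ lPiece k inv a d ↔ ∀ m, f.coeff m ≠ 0 → m ∈ expSet inv a d := by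
  rw [lPiece, AddMonoidAlgebra.mem_supported]
  exact ⟨fun h m hm => h (by simpa using hm), fun h m hm => h m (by simpa using hm)⟩

theorem lPiece_mono {inv inv' : Fin n × Fin 2 → Prop} (h : ∀ v, inv v → inv' v)
    (a : Fin n → ℤ) (d : ℤ) : lPiece k inv a d ≤ lPiece k inv' a d :=
  AddMonoidAlgebra.supported_mono fun _ hm => ⟨fun v hv => hm.1 v fun h' => hv (h v h'), hm.2⟩

theorem mul_mem_lPiece {inv inv' : Fin n × Fin 2 → Prop} {a a' : Fin n → ℤ} {d d' : ℤ}
    {f g : Laurent k n} (hf : f ∈ lPiece k inv a d) (hg : g ∈ lPiece k inv' a' d') :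
    f * g ∈ lPiece k (fun v => inv v ∨ inv' v) (a + a') (d + d') := by
  classical
  intro m hm
  obtain ⟨u, hu, v, hv, rfl⟩ := Finset.mem_add.1 (AddMonoidAlgebra.support_coeff_mul_subset f g hm)
  obtain ⟨hu1, hu2⟩ := hf hu
  obtain ⟨hv1, hv2⟩ := hg hv
  refine ⟨fun w hw => ?_, fun i => ?_⟩
  · have := hu1 w fun h => hw (Or.inl h)
    have := hv1 w fun h => hw (Or.inr h)
    simp only [Pi.add_apply]; omega
  · have := hu2 i
    have := hv2 i
    simp only [Pi.add_apply]; omega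

theorem toLaurent_mem_lPiece {a : Fin n → ℤ} {d : ℤ} {f : Poly k n} (hf : f ∈ piece k a d) :
    toLaurent k n f ∈ lPiece k (fun _ => False) a d := by
  classical
  intro m hm
  have h := Finsupp.mapDomain_support (f := castExp n) (s := AddMonoidAlgebra.coeff f) hm
  obtain ⟨m', hm', rfl⟩ := Finset.mem_image.1 h
  exact ⟨fun v _ => Nat.cast_nonneg _, fun i => hf hm' i⟩

theorem exists_toLaurent_eq {a : Fin n → ℤ} {d : ℤ} {g : Laurent k n}
    (hg : g ∈ lPiece k (fun _ => False) a d) : ∃ f ∈ piece k a d, toLaurent k n f = g := by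
  have hr : ∀ m ∈ expSet (fun _ => False) a d, ∃ m', castExp n m' = m := by
    intro m hm
    refine ⟨Finsupp.equivFunOnFinite.symm fun v => (m v).toNat, ?_⟩
    funext v
    exact Int.toNat_of_nonneg (hm.1 v id)
  refine ⟨AddMonoidAlgebra.comapDomain (castExp n) castExp_injective g, ?_,
    AddMonoidAlgebra.mapDomain_comapDomain (fun m hm => hr m (hg hm)) castExp_injective⟩
  intro m hm
  have hm' : castExp n m ∈ g.coeff.support := by
    simpa [MvPolynomial.support] using hm
  exact fun i => (hg hm').2 i

/-- The variables inverted at `τ`. -/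
def inv (τ : Ix n) (v : Fin n × Fin 2) : Prop := τ v.1 = none ∨ τ v.1 = some v.2

/-- The pairs `(i, b)` with negative exponent. -/
abbrev neg (m : Fin n × Fin 2 → ℤ) (i : Fin n) (b : Fin 2) : Prop := m (i, b) < 0

/-- The exponents in degree `d` that are negative in precisely `l` pairs of variables, and
nonnegative in all the other variables. -/
def specialExp (a : Fin n → ℤ) (l : ℕ) (d : ℤ) : Set (Fin n × Fin 2 → ℤ) :=
  {m | (∀ i, m (i, 0) + m (i, 1) = d + a i) ∧ (∀ i, m (i, 0) < 0 ↔ m (i, 1) < 0) ∧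
    (full (neg m)).card = l}

/-- Functions in degree `(l, d)` of the double complex. -/
def InDeg (a : Fin n → ℤ) (l : ℕ) (d : ℤ) (α : Ix n → Laurent k n) : Prop :=
  ∀ τ, ((both τ).card = l → α τ ∈ lPiece k (inv τ) a d) ∧ ((both τ).card ≠ l → α τ = 0)

theorem InDeg.supp {a : Fin n → ℤ} {l : ℕ} {d : ℤ} {α : Ix n → Laurent k n} (hα : InDeg a l d α)
    (m : Fin n × Fin 2 → ℤ) : Supp (neg m) l fun τ => (α τ).coeff m := by
  intro τ h
  have hl : (both τ).card = l := by
    by_contra hl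
    simp [(hα τ).2 hl] at h
  refine ⟨hl, fun i b hb => ?_⟩
  by_contra h'
  exact absurd ((mem_lPiece.1 ((hα τ).1 hl) m h).1 (i, b) h') (not_le.2 hb)

theorem InDeg.sum_eq {a : Fin n → ℤ} {l : ℕ} {d : ℤ} {α : Ix n → Laurent k n}
    (hα : InDeg a l d α) {m : Fin n × Fin 2 → ℤ} {τ : Ix n} (h : (α τ).coeff m ≠ 0) (i : Fin n) :
    m (i, 0) + m (i, 1) = d + a i := by
  have hl : (both τ).card = l := by
    by_contra hl
    simp [(hα τ).2 hl] at h
  exact (mem_lPiece.1 ((hα τ).1 hl) m h).2 i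

theorem both_basePt (m : Fin n × Fin 2 → ℤ) : both (basePt (neg m)) = full (neg m) := by
  ext i
  rw [mem_both]
  simp only [basePt, full, Finset.mem_filter, Finset.mem_univ, true_and]
  split_ifs <;> simp_all

/-- At a pair of mixed signs the base point inverts only the variable with nonnegative exponent, so
the coefficient there must vanish. -/
theorem mem_specialExp_of_coeff_ne_zero {a : Fin n → ℤ} {l : ℕ} {d : ℤ} {α : Ix n → Laurent k n}
    (hα : InDeg a l d α) {m : Fin n × Fin 2 → ℤ} (h : (α (basePt (neg m))).coeff m ≠ 0) :
    m ∈ specialExp a l d := by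
  obtain ⟨h1, h2⟩ := hα.supp m _ h
  refine ⟨hα.sum_eq h, fun i => ?_, by rw [← h1, both_basePt]⟩
  have h3 := h2 i 0
  have h4 := h2 i 1
  simp only [basePt, neg] at h3 h4
  constructor
  · intro h5
    by_contra h6
    simp [h5, h6] at h3
  · intro h5
    by_contra h6
    simp [h5, h6] at h4

/-- The differential acts on each coefficient separately, so the problem splits over the
multidegrees m. -/
theorem exists_diff_eq_of_coeff_eq_zero {a : Fin n → ℤ} {l : ℕ} {d : ℤ} {α : Ix n → Laurent k n}
    (hα : InDeg a (l + 1) d α) (hd : PairCech.diff k n (Laurent k n) α = 0)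
    (h0 : ∀ m ∈ specialExp a (l + 1) d, (α (basePt (neg m))).coeff m = 0) :
    ∃ β, InDeg a l d β ∧ PairCech.diff k n (Laurent k n) β = α := by
  classical
  let c : (Fin n × Fin 2 → ℤ) → Laurent k n →+ k := fun m =>
    { toFun := fun f => f.coeff m
      map_zero' := by simp
      map_add' := fun f g => by simp }
  have key : ∀ m, ∃ β : Ix n → k, Supp (neg m) l β ∧
      PairCech.diff k n k β = (fun τ => (α τ).coeff m) ∧
      -- This clause makes the chosen primitives vanish for all but finitely many m, so that they
      -- assemble to Laurent polynomials.
      ((∀ τ, (α τ).coeff m = 0) → β = 0) := by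
    intro m
    by_cases hz : ∀ τ, (α τ).coeff m = 0
    · exact ⟨0, fun τ h => absurd rfl h, by rw [map_zero]; funext τ; exact (hz τ).symm,
        fun _ => rfl⟩
    · have h1 : PairCech.diff k n k (fun τ => (α τ).coeff m) = 0 := by
        refine (diff_comp k (c m) α).trans ?_
        rw [hd]
        funext τ
        simp
      have h2 : (α (basePt (neg m))).coeff m = 0 := by
        by_contra h
        exact h (h0 m (mem_specialExp_of_coeff_ne_zero hα h))
      obtain ⟨β, hβ, h⟩ := exists_diff_eq k (hα.supp m) h1 h2
      exact ⟨β, hβ, h, fun h => absurd h hz⟩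
  choose β hβ hdβ hβ0 using key
  let F : Finset (Fin n × Fin 2 → ℤ) := Finset.univ.biUnion fun τ => (α τ).coeff.support
  have hF : ∀ m τ, β m τ ≠ 0 → m ∈ F := by
    intro m τ h
    by_contra hm
    refine h (congrFun (hβ0 m fun τ' => ?_) τ)
    by_contra h'
    exact hm (Finset.mem_biUnion.2 ⟨τ', Finset.mem_univ _, by simpa using h'⟩)
  let γ : Ix n → Laurent k n := fun τ =>
    AddMonoidAlgebra.ofCoeff (Finsupp.onFinset F (fun m => β m τ) fun m => hF m τ)
  have hγ : ∀ m τ, (γ τ).coeff m = β m τ := fun m τ => rfl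
  refine ⟨γ, fun τ => ⟨fun hl => mem_lPiece.2 fun m hm => ?_, fun hl => ?_⟩, ?_⟩
  · rw [hγ] at hm
    have h1 : ∃ τ', (α τ').coeff m ≠ 0 := by
      by_contra h
      push Not at h
      exact hm (congrFun (hβ0 m h) τ)
    obtain ⟨τ', h1⟩ := h1
    refine ⟨fun v hv => ?_, hα.sum_eq h1⟩
    by_contra h
    exact hv ((hβ m τ hm).2 v.1 v.2 (not_le.1 h))
  · ext m
    by_contra h
    exact hl (hβ m τ h).1
  · funext τ
    ext m
    have h1 := congrFun (hdβ m) τ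
    have h2 := congrFun (diff_comp k (c m) γ) τ
    exact h2.symm.trans h1

end Segre
end

noncomputable section

open AltSign CechVec PairCech

namespace Segre

variable {k : Type u} [Field k] {n : ℕ}

/-! ### Graded parts of the polynomial ring -/

theorem mul_mem_piece {a a' : Fin n → ℤ} {d d' : ℤ} {f g : Poly k n} (hf : f ∈ piece k a d)
    (hg : g ∈ piece k a' d') : f * g ∈ piece k (a + a') (d + d') := by
  classical
  rw [piece, MvPolynomial.mem_restrictSupport_iff] at *
  intro m hm
  obtain ⟨u, hu, v, hv, rfl⟩ := Finset.mem_add.1 (MvPolynomial.support_mul f g hm)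
  intro i
  have h1 := hf hu i
  have h2 := hg hv i
  simp only [pairDeg, Finsupp.add_apply, Nat.cast_add, Pi.add_apply] at *
  omega

theorem one_mem_piece : (1 : Poly k n) ∈ piece k (0 : Fin n → ℤ) 0 := by
  rw [piece, ← MvPolynomial.C_1, MvPolynomial.C_apply, MvPolynomial.monomial_mem_restrictSupport]
  exact Or.inl fun i => by simp [pairDeg]

theorem pow_mem_piece {d : ℤ} {f : Poly k n} (hf : f ∈ piece k 0 d) (t : ℕ) :
    f ^ t ∈ piece k (0 : Fin n → ℤ) (t * d) := by
  induction t with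
  | zero => simpa using one_mem_piece
  | succ t ih =>
    have := mul_mem_piece ih hf
    rw [pow_succ]
    convert this using 2
    · simp
    · push_cast; ring

theorem piece_le_total (a : Fin n → ℤ) (d : ℤ) : piece k a d ≤ total k a :=
  MvPolynomial.restrictSupport_mono _ fun _ hm => ⟨d, hm⟩

/-- The projection onto the degree `d` part. -/
def proj (k : Type u) [Field k] (a : Fin n → ℤ) (d : ℤ) : Poly k n →ₗ[k] Poly k n where
  toFun f := AddMonoidAlgebra.ofCoeff
    ((AddMonoidAlgebra.coeff f).filter fun m => ∀ i, pairDeg m i = d + a i)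
  map_add' f g := by
    rw [AddMonoidAlgebra.coeff_add, Finsupp.filter_add]; rfl
  map_smul' c f := by
    rw [AddMonoidAlgebra.coeff_smul, Finsupp.filter_smul]; rfl

theorem coeff_proj (a : Fin n → ℤ) (d : ℤ) (f : Poly k n) (m : Fin n × Fin 2 →₀ ℕ) :
    (proj k a d f).coeff m = if ∀ i, pairDeg m i = d + a i then f.coeff m else 0 := rfl

theorem mem_piece {a : Fin n → ℤ} {d : ℤ} {f : Poly k n} :
    f ∈ piece k a d ↔ ∀ m, f.coeff m ≠ 0 → ∀ i, pairDeg m i = d + a i := by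
  rw [piece, MvPolynomial.mem_restrictSupport_iff]
  exact ⟨fun h m hm => h (by simpa using hm), fun h m hm => h m (by simpa using hm)⟩

theorem proj_mem (a : Fin n → ℤ) (d : ℤ) (f : Poly k n) : proj k a d f ∈ piece k a d := by
  rw [mem_piece]
  intro m hm
  by_contra h
  rw [coeff_proj, if_neg h] at hm
  exact hm rfl

theorem proj_self {a : Fin n → ℤ} {d : ℤ} {f : Poly k n} (hf : f ∈ piece k a d) :
    proj k a d f = f := by
  ext m
  rw [coeff_proj]
  split_ifs with h
  · rfl
  · by_contra h'
    exact h (mem_piece.1 hf m (Ne.symm h'))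

theorem proj_ne (hn : 0 < n) {a : Fin n → ℤ} {d e : ℤ} {f : Poly k n} (hf : f ∈ piece k a e)
    (h : d ≠ e) : proj k a d f = 0 := by
  ext m
  rw [coeff_proj]
  split_ifs with h'
  · by_contra h0
    have h1 := mem_piece.1 hf m h0 ⟨0, hn⟩
    have h2 := h' ⟨0, hn⟩
    omega
  · rfl

theorem exists_sum_proj (hn : 0 < n) {a : Fin n → ℤ} {f : Poly k n} (hf : f ∈ total k a) :
    ∃ F : Finset ℤ, ∑ d ∈ F, proj k a d f = f := by
  classical
  let deg : (Fin n × Fin 2 →₀ ℕ) → ℤ := fun m => pairDeg m ⟨0, hn⟩ - a ⟨0, hn⟩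
  refine ⟨f.support.image deg, ?_⟩
  ext m
  rw [MvPolynomial.coeff_sum]
  simp only [coeff_proj]
  by_cases hm : f.coeff m = 0
  · simp [hm]
  · obtain ⟨d, hd⟩ := hf (MvPolynomial.mem_support_iff.2 hm)
    have hdeg : ∀ e, (∀ i, pairDeg m i = e + a i) ↔ e = deg m := by
      intro e
      have h1 := hd ⟨0, hn⟩
      constructor
      · intro h
        have h2 := h ⟨0, hn⟩
        simp only [deg]; omega
      · rintro rfl i
        have h2 := hd i
        simp only [deg]; omega
    simp only [hdeg]
    rw [Finset.sum_ite_eq' _ (deg m), if_pos]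
    exact Finset.mem_image_of_mem _ (MvPolynomial.mem_support_iff.2 hm)

theorem proj_mul (hn : 0 < n) {s d : ℤ} {w f : Poly k n} (hw : w ∈ piece k 0 s)
    (hf : f ∈ total k 0) : proj k 0 d (w * f) = w * proj k 0 (d - s) f := by
  obtain ⟨F, hF⟩ := exists_sum_proj hn hf
  have h1 : ∀ e, proj k 0 d (w * proj k 0 e f) = w * proj k 0 (d - s) (proj k 0 e f) := by
    intro e
    have h2 := mul_mem_piece hw (proj_mem 0 e f)
    rw [add_zero] at h2
    by_cases he : d = s + e
    · subst he
      rw [proj_self h2, add_sub_cancel_left, proj_self (proj_mem 0 e f)]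
    · rw [proj_ne hn h2 he, proj_ne hn (proj_mem 0 e f) (by omega), mul_zero]
  conv_lhs => rw [← hF]
  conv_rhs => rw [← hF]
  rw [Finset.mul_sum, map_sum, map_sum, Finset.mul_sum]
  exact Finset.sum_congr rfl fun e _ => h1 e

theorem proj_mem_T (d : ℤ) (f : Poly k n) : proj k 0 d f ∈ T k n :=
  piece_le_total 0 d (proj_mem 0 d f)

/-- Homogeneous elements of an ideal with homogeneous generators of equal degrees. -/
theorem proj_mem_span (hn : 0 < n) {N : ℕ} {s : ℤ} {w : Fin N → T k n}
    (hw : ∀ i, (w i : Poly k n) ∈ piece k 0 s) {x : T k n} (hx : x ∈ Ideal.span (Set.range w))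
    (d : ℤ) : ∃ c : Fin N → T k n, (∀ i, (c i : Poly k n) ∈ piece k 0 (d - s)) ∧
      proj k 0 d x = ∑ i, (w i : Poly k n) * c i := by
  obtain ⟨c, rfl⟩ := (Ideal.mem_span_range_iff_exists_fun).1 hx
  refine ⟨fun i => ⟨proj k 0 (d - s) (c i), proj_mem_T _ _⟩, fun i => proj_mem _ _ _, ?_⟩
  rw [AddSubmonoidClass.coe_finsetSum, map_sum]
  refine Finset.sum_congr rfl fun i _ => ?_
  rw [← proj_mul hn (hw i) (c i).2, mul_comm (c i) (w i)]
  rfl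

theorem X_mem_piece (i : Fin n) (b : Fin 2) :
    (MvPolynomial.X (i, b) : Poly k n) ∈ piece k (Pi.single i 1) 0 := by
  rw [piece, MvPolynomial.X, MvPolynomial.monomial_mem_restrictSupport]
  refine Or.inl fun l => ?_
  by_cases h : i = l
  · subst h
    fin_cases b <;> simp [pairDeg]
  · simp [pairDeg, h]

theorem prod_X_mem_piece (b : Fin n → Fin 2) :
    (∏ i, MvPolynomial.X (i, b i) : Poly k n) ∈ piece k 0 1 := by
  have h : ∀ s : Finset (Fin n), (∏ i ∈ s, MvPolynomial.X (i, b i) : Poly k n) ∈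
      piece k (∑ i ∈ s, Pi.single i 1) 0 := by
    intro s
    induction s using Finset.induction_on with
    | empty => simpa using one_mem_piece
    | insert i s hi ih =>
      rw [Finset.prod_insert hi, Finset.sum_insert hi]
      simpa using mul_mem_piece (X_mem_piece i (b i)) ih
  have h1 := h Finset.univ
  rw [mem_piece] at h1 ⊢
  intro m hm i
  have h2 := h1 m hm i
  rw [Finset.univ_sum_single (fun _ : Fin n => (1 : ℤ))] at h2
  simpa using h2

/-! ### Consequences of the finiteness of `T_n` over `A_n` -/

variable {z : Fin (n + 1) → T k n}

/-- Modulo the z i the ring A_n becomes k, so integrality over A_n turns into integrality over k. -/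
theorem exists_algebraMap_eq_mk (a : A z) : ∃ c : k,
    algebraMap k (T k n ⧸ Ideal.span (Set.range z)) c = Ideal.Quotient.mk _ (a : T k n) := by
  obtain ⟨a, ha⟩ := a
  induction ha using Algebra.adjoin_induction with
  | mem x hx =>
    exact ⟨0, by rw [map_zero]; exact (Ideal.Quotient.eq_zero_iff_mem.2 (Ideal.subset_span hx)).symm⟩
  | algebraMap c => exact ⟨c, rfl⟩
  | add x y _ _ hx hy =>
    obtain ⟨c, hc⟩ := hx
    obtain ⟨d, hd⟩ := hy
    exact ⟨c + d, by rw [map_add, hc, hd]; rfl⟩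
  | mul x y _ _ hx hy =>
    obtain ⟨c, hc⟩ := hx
    obtain ⟨d, hd⟩ := hy
    exact ⟨c * d, by rw [map_mul, hc, hd]; rfl⟩

theorem isIntegral_quotient (hfin : Module.Finite (A z) (T k n)) (x : T k n) :
    IsIntegral k (Ideal.Quotient.mk (Ideal.span (Set.range z)) x) := by
  obtain ⟨P, hP, h⟩ := (Algebra.IsIntegral.of_finite (A z) (T k n)).isIntegral x
  let φ : A z →+* T k n ⧸ Ideal.span (Set.range z) := (Ideal.Quotient.mk _).comp (A z).val.toRingHom
  have hl : P.map φ ∈ Polynomial.lifts (algebraMap k (T k n ⧸ Ideal.span (Set.range z))) := by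
    rw [Polynomial.lifts_iff_coeff_lifts]
    intro i
    obtain ⟨c, hc⟩ := exists_algebraMap_eq_mk (P.coeff i)
    exact ⟨c, by rw [hc, Polynomial.coeff_map]; rfl⟩
  obtain ⟨Q, hQ, -, hQm⟩ := Polynomial.lifts_and_natDegree_eq_and_monic hl (hP.map φ)
  refine ⟨Q, hQm, ?_⟩
  rw [← Polynomial.eval_map, hQ, Polynomial.eval_map]
  have := congrArg (Ideal.Quotient.mk (Ideal.span (Set.range z))) h
  rw [Polynomial.hom_eval₂, map_zero] at this
  exact this

/-- A monic Q with Q(x) in the ideal (z) exists. For x of degree one, the component of Q(x) in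
degree deg Q is exactly the corresponding power of x, and it lies in (z) because the ideal is
homogeneous. -/
theorem mem_radical_span (hn : 0 < n) (hz : ∀ i, (z i : Poly k n) ∈ piece k (0 : Fin n → ℤ) 1)
    (hfin : Module.Finite (A z) (T k n)) {x : T k n} (hx : (x : Poly k n) ∈ piece k 0 1) :
    x ∈ (Ideal.span (Set.range z)).radical := by
  obtain ⟨Q, hQ, h⟩ := isIntegral_quotient hfin x
  have h1 : Polynomial.aeval x Q ∈ Ideal.span (Set.range z) := by
    rw [← Ideal.Quotient.eq_zero_iff_mem, ← h]
    exact (Polynomial.hom_eval₂ Q (algebraMap k (T k n)) (Ideal.Quotient.mk _) x)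
  obtain ⟨c, -, hc⟩ := proj_mem_span hn hz h1 Q.natDegree
  have h2 : proj k 0 Q.natDegree (Polynomial.aeval x Q : T k n) = (x : Poly k n) ^ Q.natDegree := by
    have h3 : ((Polynomial.aeval x Q : T k n) : Poly k n) =
        ∑ i ∈ Finset.range (Q.natDegree + 1), Q.coeff i • (x : Poly k n) ^ i := by
      rw [Polynomial.aeval_eq_sum_range, AddSubmonoidClass.coe_finsetSum]
      rfl
    rw [h3, map_sum, Finset.sum_eq_single_of_mem Q.natDegree (by simp)]
    · have := pow_mem_piece hx Q.natDegree
      rw [mul_one] at this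
      rw [hQ.coeff_natDegree, one_smul, proj_self this]
    · intro i _ hi
      have := pow_mem_piece hx i
      rw [mul_one] at this
      rw [map_smul, proj_ne hn this (by exact_mod_cast hi.symm), smul_zero]
  refine ⟨Q.natDegree, ?_⟩
  have h4 : x ^ Q.natDegree = ∑ i, z i * c i := by
    apply Subtype.ext
    rw [AddSubmonoidClass.coe_finsetSum]
    exact h2.symm.trans hc
  rw [h4]
  exact Ideal.sum_mem _ fun i _ => Ideal.mul_mem_right _ _ (Ideal.subset_span ⟨i, rfl⟩)

/-- The ideals of the z i and of the z i ^ t have the same radical; taking the component of degree M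
makes the coefficients homogeneous. -/
theorem exists_pow_eq_sum (hn : 0 < n) (hz : ∀ i, (z i : Poly k n) ∈ piece k (0 : Fin n → ℤ) 1)
    (hfin : Module.Finite (A z) (T k n)) {x : T k n} (hx : (x : Poly k n) ∈ piece k 0 1) (t : ℕ) :
    ∃ (M : ℕ) (c : Fin (n + 1) → T k n), (∀ i, (c i : Poly k n) ∈ piece k 0 ((M : ℤ) - t)) ∧
      (x : Poly k n) ^ M = ∑ i, (z i : Poly k n) ^ t * c i := by
  have h1 : Ideal.span (Set.range z) ≤ (Ideal.span (Set.range fun i => z i ^ t)).radical := by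
    rw [Ideal.span_le]
    rintro _ ⟨i, rfl⟩
    exact ⟨t, Ideal.subset_span ⟨i, rfl⟩⟩
  obtain ⟨M, hM⟩ := (Ideal.radical_le_radical_iff.2 h1) (mem_radical_span hn hz hfin hx)
  have hzt : ∀ i, ((z i ^ t : T k n) : Poly k n) ∈ piece k 0 (t : ℤ) := by
    intro i
    have := pow_mem_piece (hz i) t
    rwa [mul_one] at this
  obtain ⟨c, hc, h⟩ := proj_mem_span hn hzt hM M
  refine ⟨M, c, hc, ?_⟩
  have := pow_mem_piece hx M
  rw [mul_one] at this
  rw [show ((x ^ M : T k n) : Poly k n) = (x : Poly k n) ^ M from rfl, proj_self this] at h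
  exact h

/-! ### The `z i` are nonzero -/

theorem prod_X_mem_T (i : Fin n) (b : Fin 2) :
    (∏ l ∈ Finset.univ.erase i, MvPolynomial.X (l, 1)) * MvPolynomial.X (i, b) ∈ T k n := by
  have h : (∏ l ∈ Finset.univ.erase i, MvPolynomial.X (l, 1)) * MvPolynomial.X (i, b) =
      (∏ l, MvPolynomial.X (l, if l = i then b else 1) : Poly k n) := by
    rw [← Finset.prod_erase_mul _ _ (Finset.mem_univ i), if_pos rfl]
    congr 1
    exact Finset.prod_congr rfl fun l hl => by rw [if_neg (Finset.ne_of_mem_erase hl)]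
  rw [h]
  exact piece_le_total 0 1 (prod_X_mem_piece _)

theorem isAlgebraic_of_T (hfin : Module.Finite (A z) (T k n)) {B : Subalgebra k (Poly k n)}
    (hB : ∀ i, (z i : Poly k n) ∈ B) {f : Poly k n} (hf : f ∈ T k n) : IsAlgebraic B f := by
  have hA : ∀ a : A z, ((a : T k n) : Poly k n) ∈ B := by
    rintro ⟨a, ha⟩
    have h1 : A z ≤ B.comap (T k n).val := by
      refine Algebra.adjoin_le ?_
      rintro _ ⟨i, rfl⟩
      exact hB i
    exact h1 ha
  have h := (Algebra.IsIntegral.of_finite (A z) (T k n)).isIntegral (⟨f, hf⟩ : T k n)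
  let φ : A z →+* B :=
    { toFun := fun a => ⟨((a : T k n) : Poly k n), hA a⟩
      map_one' := rfl
      map_mul' := fun _ _ => rfl
      map_zero' := rfl
      map_add' := fun _ _ => rfl }
  exact (IsIntegral.map_of_comp_eq φ (T k n).val.toRingHom rfl h).isAlgebraic

/-- A count of transcendence degrees: over k[z] with the n - 1 variables y_l, l ≠ 0, adjoined, the
whole polynomial ring is algebraic. If one z i were zero, at most n + (n - 1) < 2n generators would
remain. -/
theorem z_ne_zero (hn : 0 < n) (hfin : Module.Finite (A z) (T k n)) (i₀ : Fin (n + 1)) :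
    z i₀ ≠ 0 := by
  intro h0
  let s : {i : Fin (n + 1) // i ≠ i₀} ⊕ {i : Fin n // i ≠ ⟨0, hn⟩} → Poly k n :=
    Sum.elim (fun i => (z i.1 : Poly k n)) (fun i => MvPolynomial.X (i.1, 1))
  let B := Algebra.adjoin k (Set.range s)
  have hB : ∀ i, (z i : Poly k n) ∈ B := by
    intro i
    by_cases hi : i = i₀
    · rw [hi, h0]; exact zero_mem _
    · exact Algebra.subset_adjoin ⟨Sum.inl ⟨i, hi⟩, rfl⟩
  have hX : ∀ i b, (∀ l, l ≠ i → IsAlgebraic B (MvPolynomial.X (l, 1) : Poly k n)) →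
      IsAlgebraic B (MvPolynomial.X (i, b) : Poly k n) := by
    intro i b hl
    -- The product of X (i, b) with all other y_l lies in T_n, so it is algebraic; the algebraic
    -- nonzero factor is then cancelled.
    refine IsAlgebraic.of_mul (y := ∏ l ∈ Finset.univ.erase i, MvPolynomial.X (l, 1)) ?_ ?_
      (isAlgebraic_of_T hfin hB (prod_X_mem_T i b))
    · exact mem_nonZeroDivisors_of_ne_zero
        (Finset.prod_ne_zero_iff.2 fun l _ => MvPolynomial.X_ne_zero _)
    · refine Finset.prod_induction _ (IsAlgebraic B) (fun _ _ => IsAlgebraic.mul)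
        isAlgebraic_one fun l h => hl l (Finset.ne_of_mem_erase h)
  have h1 : ∀ l, IsAlgebraic B (MvPolynomial.X (l, 1) : Poly k n) := by
    have h2 : ∀ l, l ≠ ⟨0, hn⟩ → IsAlgebraic B (MvPolynomial.X (l, 1) : Poly k n) := fun l hl =>
      isAlgebraic_algebraMap (⟨_, Algebra.subset_adjoin ⟨Sum.inr ⟨l, hl⟩, rfl⟩⟩ : B)
    intro l
    by_cases hl : l = ⟨0, hn⟩
    · subst hl
      exact hX _ _ h2
    · exact h2 l hl
  have halg : Algebra.IsAlgebraic B (Poly k n) := by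
    refine ⟨fun f => ?_⟩
    induction f using MvPolynomial.induction_on with
    | C a => exact isAlgebraic_algebraMap (algebraMap k B a)
    | add p q hp hq => exact hp.add hq
    | mul_X p v hp => exact hp.mul (hX v.1 v.2 fun l _ => h1 l)
  have hle : Algebra.trdeg k (Poly k n) ≤ Cardinal.mk (Set.range s) :=
    Algebra.IsAlgebraic.trdeg_le_cardinalMk k (Set.range s)
  rw [MvPolynomial.trdeg_of_isDomain] at hle
  have h3 := Cardinal.mk_range_le_lift (f := s)
  have h4 := (Cardinal.lift_le.2 hle).trans h3
  simp only [Cardinal.mk_fintype, Cardinal.lift_natCast] at h4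
  have h5 : Fintype.card (Fin n × Fin 2) ≤
      Fintype.card ({i : Fin (n + 1) // i ≠ i₀} ⊕ {i : Fin n // i ≠ ⟨0, hn⟩}) := by
    exact_mod_cast h4
  simp at h5
  omega

end Segre
end

noncomputable section

open AltSign CechVec PairCech

/-! ### The double complex for the twisted Segre product -/

namespace Segre

variable {k : Type u} [Field k] {n : ℕ} {z : Fin (n + 1) → T k n}

/-- The inclusion of the ring `A_n` into the field of rational functions. -/
def embA (z : Fin (n + 1) → T k n) : A z →ₐ[k] Frac k n :=
  (toFrac k n).comp ((toLaurent k n).comp ((T k n).val.comp (A z).val))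

instance instAlgebraFrac (z : Fin (n + 1) → T k n) : Algebra (A z) (Frac k n) :=
  (embA z).toRingHom.toAlgebra

theorem algebraMap_frac (a : A z) : algebraMap (A z) (Frac k n) a =
    toFrac k n (toLaurent k n (a : T k n)) := rfl

instance instTowerFrac (z : Fin (n + 1) → T k n) : IsScalarTower k (A z) (Frac k n) :=
  IsScalarTower.of_algebraMap_eq fun c => ((embA z).commutes c).symm

/-- The images of the `z i` in the field of rational functions. -/
abbrev zeta (z : Fin (n + 1) → T k n) (i : Fin (n + 1)) : Frac k n :=
  algebraMap (A z) (Frac k n) (gens z i)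

theorem zeta_eq (i : Fin (n + 1)) : zeta z i = toFrac k n (toLaurent k n (z i)) := rfl

theorem zeta_ne_zero (hn : 0 < n) (hfin : Module.Finite (A z) (T k n)) (i : Fin (n + 1)) :
    zeta z i ≠ 0 := by
  rw [zeta_eq, Ne, map_eq_zero_iff _ toFrac_injective, map_eq_zero_iff _ toLaurent_injective]
  exact fun h => z_ne_zero hn hfin i (Subtype.ext h)

/-- The image of `lPiece` in the field of rational functions. -/
def fPiece (k : Type u) [Field k] (inv : Fin n × Fin 2 → Prop) (a : Fin n → ℤ) (d : ℤ) :
    Submodule k (Frac k n) :=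
  (lPiece k inv a d).map (toFrac k n).toLinearMap

theorem mul_mem_fPiece {inv : Fin n × Fin 2 → Prop} {a : Fin n → ℤ} {d e : ℤ} {g : Laurent k n}
    (hg : g ∈ lPiece k inv 0 e) {f : Frac k n} (hf : f ∈ fPiece k inv a d) :
    toFrac k n g * f ∈ fPiece k inv a (d + e) := by
  obtain ⟨f, hf, rfl⟩ := hf
  refine ⟨g * f, ?_, map_mul (toFrac k n) g f⟩
  have := mul_mem_lPiece hg hf
  rw [zero_add, add_comm] at this
  exact lPiece_mono (fun v h => h.elim id id) _ _ this

theorem zeta_smul_mem (hz : ∀ i, (z i : Poly k n) ∈ piece k (0 : Fin n → ℤ) 1)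
    {inv : Fin n × Fin 2 → Prop} {a : Fin n → ℤ} {d : ℤ} (i : Fin (n + 1)) {f : Frac k n}
    (hf : f ∈ fPiece k inv a d) : zeta z i * f ∈ fPiece k inv a (d + 1) :=
  mul_mem_fPiece (lPiece_mono (fun _ h => h.elim) _ _ (toLaurent_mem_lPiece (hz i))) hf

/-- The index of an inverted variable. -/
def pick (τ : Ix n) (i : Fin n) : Fin 2 := (τ i).getD 0

theorem inv_pick (τ : Ix n) (i : Fin n) : inv τ (i, pick τ i) := by
  unfold inv pick
  rcases h : τ i with _ | c
  · exact Or.inl rfl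
  · exact Or.inr rfl

theorem exists_mul_prod_X_eq_one (τ : Ix n) : ∃ v ∈ lPiece k (inv τ) 0 (-1),
    v * toLaurent k n (∏ i, MvPolynomial.X (i, pick τ i)) = 1 := by
  let m : Fin n × Fin 2 →₀ ℕ := ∑ i, Finsupp.single (i, pick τ i) 1
  have hm : ∀ i b, m (i, b) = if b = pick τ i then 1 else 0 := by
    intro i b
    simp only [m, Finsupp.finsetSum_apply, Finsupp.single_apply, Prod.mk.injEq]
    rw [Finset.sum_eq_single i]
    · simp [eq_comm]
    · intro l _ hl; simp [hl]
    · simp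
  have hX : (∏ i, MvPolynomial.X (i, pick τ i) : Poly k n) = MvPolynomial.monomial m 1 := by
    rw [MvPolynomial.monomial_sum_one]; rfl
  refine ⟨AddMonoidAlgebra.single (-castExp n m) 1, ?_, ?_⟩
  · rw [mem_lPiece]
    intro m' hm'
    have h : m' = -castExp n m := by
      by_contra h
      exact hm' (by simp [Ne.symm h])
    subst h
    refine ⟨fun v hv => ?_, fun i => ?_⟩
    · have : v.2 ≠ pick τ v.1 := fun h => hv (by
        have := inv_pick τ v.1
        rwa [← h] at this)
      have h2 := hm v.1 v.2
      rw [if_neg this] at h2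
      change 0 ≤ -((m v : ℕ) : ℤ)
      rw [show m v = 0 from h2]; simp
    · change -((m (i, 0) : ℕ) : ℤ) + -((m (i, 1) : ℕ) : ℤ) = -1 + 0
      rw [hm, hm]
      generalize pick τ i = b
      fin_cases b <;> simp
  · have : toLaurent k n (MvPolynomial.monomial m 1) = AddMonoidAlgebra.single (castExp n m) 1 :=
      AddMonoidAlgebra.mapDomain_single
    rw [hX, this, AddMonoidAlgebra.single_mul_single, neg_add_cancel, mul_one]
    rfl

theorem pow_mem_lPiece {inv : Fin n × Fin 2 → Prop} {d : ℤ} {f : Laurent k n}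
    (hf : f ∈ lPiece k inv 0 d) (t : ℕ) : f ^ t ∈ lPiece k inv 0 (t * d) := by
  induction t with
  | zero =>
    rw [mem_lPiece]
    intro m hm
    have h : m = 0 := by
      by_contra h
      exact hm (by simp [AddMonoidAlgebra.one_def, Ne.symm h])
    subst h
    exact ⟨fun v _ => le_rfl, fun i => by simp⟩
  | succ t ih =>
    have := lPiece_mono (fun v h => h.elim id id) _ _ (mul_mem_lPiece ih hf)
    rw [pow_succ]
    convert this using 2
    · simp
    · push_cast; ring

/-- The partition of unity that contracts the Čech complexes of the `fPiece`s. -/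
theorem exists_partition (hn : 0 < n) (hz : ∀ i, (z i : Poly k n) ∈ piece k (0 : Fin n → ℤ) 1)
    (hfin : Module.Finite (A z) (T k n)) (τ : Ix n) (t : ℕ) :
    ∃ c : Fin (n + 1) → Frac k n, ∑ i, zeta z i ^ t * c i = 1 ∧
      ∀ i a d f, f ∈ fPiece k (inv τ) a d → c i * f ∈ fPiece k (inv τ) a (d - t) := by
  obtain ⟨v, hv, hvu⟩ := exists_mul_prod_X_eq_one (k := k) τ
  have hu := prod_X_mem_piece (k := k) (pick τ)
  obtain ⟨M, c, hc, h⟩ := exists_pow_eq_sum hn hz hfin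
    (x := ⟨_, piece_le_total 0 1 hu⟩) hu t
  -- With u the inverted monomial and v its inverse, the relation for u^M is divided by u^M. The
  -- degrees add up to (M - t) - M = -t.
  refine ⟨fun i => toFrac k n (v ^ M * toLaurent k n (c i)), ?_, fun i a d f hf => ?_⟩
  · have h1 := congrArg (fun x => toFrac k n (v ^ M * toLaurent k n x)) h
    simp only [map_pow, map_sum, map_mul] at h1
    rw [← mul_pow, ← map_mul, hvu, map_one, one_pow, Finset.mul_sum] at h1
    rw [h1]
    refine Finset.sum_congr rfl fun i _ => ?_
    simp only [zeta_eq, map_mul, map_pow]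
    ring
  · have h2 := lPiece_mono (fun v h => h.elim id False.elim) _ _
      (mul_mem_lPiece (pow_mem_lPiece hv M) (toLaurent_mem_lPiece (hc i)))
    have h3 := mul_mem_fPiece (inv := inv τ) (a := a) (d := d) (e := -t)
      (g := v ^ M * toLaurent k n (c i)) (by
        convert h2 using 2
        · simp
        · ring) hf
    exact h3

/-- The terms of the double complex. -/
def dFam (hz : ∀ i, (z i : Poly k n) ∈ piece k (0 : Fin n → ℤ) 1) (a : Fin n → ℤ) (l : ℕ) :
    Fam k (Ix n → Frac k n) (zeta z) where
  gr d :=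
    { carrier := {α | ∀ τ, ((both τ).card = l → α τ ∈ fPiece k (inv τ) a d) ∧
        ((both τ).card ≠ l → α τ = 0)}
      zero_mem' := fun τ => ⟨fun _ => zero_mem _, fun _ => rfl⟩
      add_mem' := by
        intro α β hα hβ τ
        exact ⟨fun h => add_mem ((hα τ).1 h) ((hβ τ).1 h), fun h => by
          rw [Pi.add_apply, (hα τ).2 h, (hβ τ).2 h, add_zero]⟩
      smul_mem' := by
        intro c α hα τ
        exact ⟨fun h => Submodule.smul_mem _ c ((hα τ).1 h), fun h => by
          rw [Pi.smul_apply, (hα τ).2 h, smul_zero]⟩ }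
  smul_mem' i d α hα τ := ⟨fun h => zeta_smul_mem hz i ((hα τ).1 h), fun h => by
    rw [Pi.smul_apply, (hα τ).2 h, smul_zero]⟩

variable (hz : ∀ i, (z i : Poly k n) ∈ piece k (0 : Fin n → ℤ) 1) (a : Fin n → ℤ)

theorem mem_dFam_iff {l : ℕ} {d : ℤ} {α : Ix n → Frac k n} : α ∈ (dFam hz a l).gr d ↔
    ∃ β : Ix n → Laurent k n, InDeg a l d β ∧ (fun τ => toFrac k n (β τ)) = α := by
  constructor
  · intro hα
    have : ∀ τ, ∃ f, (((both τ).card = l → f ∈ lPiece k (inv τ) a d) ∧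
        ((both τ).card ≠ l → f = 0)) ∧ toFrac k n f = α τ := by
      intro τ
      by_cases h : (both τ).card = l
      · obtain ⟨f, hf, hf'⟩ := (hα τ).1 h
        exact ⟨f, ⟨fun _ => hf, fun h' => absurd h h'⟩, hf'⟩
      · exact ⟨0, ⟨fun h' => absurd h' h, fun _ => rfl⟩, by rw [(hα τ).2 h, map_zero]⟩
    choose β hβ h using this
    exact ⟨β, hβ, funext h⟩
  · rintro ⟨β, hβ, rfl⟩ τ
    exact ⟨fun h => ⟨_, (hβ τ).1 h, rfl⟩, fun h => by simp [(hβ τ).2 h]⟩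

theorem diff_toFrac (β : Ix n → Laurent k n) :
    PairCech.diff (Frac k n) n (Frac k n) (fun τ => toFrac k n (β τ)) =
      fun τ => toFrac k n (PairCech.diff k n (Laurent k n) β τ) := by
  funext τ
  simp [PairCech.diff_apply, edge]

theorem inv_update_some {τ : Ix n} {i : Fin n} (hi : τ i = none) (b : Fin 2)
    (v : Fin n × Fin 2) (h : inv (Function.update τ i (some b)) v) : inv τ v := by
  by_cases hv : v.1 = i
  · exact Or.inl (hv ▸ hi)
  · simpa [inv, hv] using h

theorem fPiece_mono {inv inv' : Fin n × Fin 2 → Prop} (h : ∀ v, inv v → inv' v)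
    (a : Fin n → ℤ) (d : ℤ) : fPiece k inv a d ≤ fPiece k inv' a d :=
  Submodule.map_mono (lPiece_mono h a d)

theorem diff_mem_dFam {l : ℕ} {d : ℤ} {α : Ix n → Frac k n} (hα : α ∈ (dFam hz a l).gr d) :
    PairCech.diff (Frac k n) n (Frac k n) α ∈ (dFam hz a (l + 1)).gr d := by
  intro τ
  rw [PairCech.diff_apply]
  constructor
  · intro h
    refine Submodule.sum_mem _ fun i hi => zsmul_mem (sub_mem ?_ ?_) _
    all_goals
      refine fPiece_mono (inv_update_some (mem_both.1 hi) _) _ _ ((hα _).1 ?_)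
      rw [both_update_some, Finset.card_erase_of_mem hi, h, Nat.add_sub_cancel]
  · intro h
    refine Finset.sum_eq_zero fun i hi => ?_
    have h1 : ∀ b, (both (Function.update τ i (some b))).card ≠ l := by
      intro b
      rw [both_update_some]
      have := Finset.card_erase_add_one hi
      omega
    rw [edge, (hα _).2 (h1 1), (hα _).2 (h1 0), sub_zero, smul_zero]

theorem dFam_contractible (hn : 0 < n) (hfin : Module.Finite (A z) (T k n)) (l : ℕ) :
    (dFam hz a l).Contractible := by
  intro t
  choose c hc1 hc2 using fun τ => exists_partition hn hz hfin τ t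
  refine ⟨fun i => LinearMap.pi fun τ => c τ i • LinearMap.proj τ, fun v => ?_,
    fun i d v hv τ => ⟨fun h => ?_, fun h => ?_⟩⟩
  · funext τ
    have : v τ = (∑ i, zeta z i ^ t * c τ i) * v τ := by rw [hc1, one_mul]
    rw [Finset.sum_apply]
    conv_rhs => rw [this, Finset.sum_mul]
    refine Finset.sum_congr rfl fun i _ => ?_
    simp [mul_assoc]
  · change c τ i * v τ ∈ _
    exact hc2 τ i a d _ ((hv τ).1 h)
  · change c τ i * v τ = 0
    rw [(hv τ).2 h, mul_zero]

/-- Two negative exponents cannot have the nonnegative sum d + a i. This is the vanishing of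
H^1(P^1, O(e)) for e ≥ 0. -/
theorem specialExp_eq_empty (ha : ∀ i, 0 ≤ a i) (l : ℕ) {d : ℤ} (hd : 0 ≤ d) :
    specialExp a (l + 1) d = ∅ := by
  ext m
  simp only [Set.mem_empty_iff_false, iff_false]
  rintro ⟨h1, -, h3⟩
  obtain ⟨i, hi⟩ := Finset.card_pos.1 (by omega : 0 < (full (neg m)).card)
  simp only [full, neg, Finset.mem_filter, Finset.mem_univ, true_and] at hi
  have := h1 i
  have := ha i
  omega

theorem exists_of_diff_eq_zero {l : ℕ} {d : ℤ} {α : Ix n → Frac k n}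
    (hα : α ∈ (dFam hz a (l + 1)).gr d) (h : PairCech.diff (Frac k n) n (Frac k n) α = 0)
    (g : Frac k n →ₗ[k] Laurent k n) (hg : ∀ f, g (toFrac k n f) = f)
    (h0 : ∀ m ∈ specialExp a (l + 1) d, (g (α (basePt (neg m)))).coeff m = 0) :
    ∃ w ∈ (dFam hz a l).gr d, PairCech.diff (Frac k n) n (Frac k n) w = α := by
  obtain ⟨α, hα', rfl⟩ := (mem_dFam_iff hz a).1 hα
  rw [diff_toFrac] at h
  simp only [hg] at h0
  obtain ⟨β, hβ, hβ'⟩ := exists_diff_eq_of_coeff_eq_zero hα'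
    (funext fun τ => toFrac_injective ((congrFun h τ).trans (map_zero _).symm)) h0
  exact ⟨_, (mem_dFam_iff hz a).2 ⟨β, hβ, rfl⟩, by rw [diff_toFrac, hβ']⟩

/-- Used to read off Laurent coefficients by k-linear functionals on rational functions; the values
off the Laurent polynomials are immaterial. -/
theorem exists_leftInverse : ∃ g : Frac k n →ₗ[k] Laurent k n, ∀ f, g (toFrac k n f) = f := by
  obtain ⟨g, hg⟩ := LinearMap.exists_leftInverse_of_injective (toFrac k n).toLinearMap
    (LinearMap.ker_eq_bot.2 toFrac_injective)
  exact ⟨g, fun f => LinearMap.congr_fun hg f⟩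

/-- The double complex. -/
def dComplex (ha : ∀ i, 0 ≤ a i) (hn : 0 < n) (hfin : Module.Finite (A z) (T k n)) :
    AcyclicComplex k (Ix n → Frac k n) (zeta z) where
  D := dFam hz a
  diff := PairCech.diff (Frac k n) n (Frac k n)
  diff_diff := PairCech.diff_diff (Frac k n)
  diff_mem _ _ _ hv := diff_mem_dFam hz a hv
  contractible := dFam_contractible hz a hn hfin
  exact q d v hd hv h := by
    obtain ⟨g, hg⟩ := exists_leftInverse (k := k) (n := n)
    exact exists_of_diff_eq_zero hz a hv h g hg fun m hm => by
      rw [specialExp_eq_empty a ha q hd] at hm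
      exact hm.elim

variable (ha : ∀ i, 0 ≤ a i) (hn : 0 < n) (hfin : Module.Finite (A z) (T k n))

/-- The coefficients of m in the value at `basePt (neg m)`, for m special, detect whether a cycle is
a boundary. -/
theorem dim_dComplex_le (l : ℕ) (d : ℤ) [Fintype (specialExp a (l + 1) d)] :
    Subquot.dim (((dComplex hz a ha hn hfin).Z (l + 1)).gr d)
      (((dComplex hz a ha hn hfin).B l).gr d) ≤ Fintype.card (specialExp a (l + 1) d) := by
  obtain ⟨g, hg⟩ := exists_leftInverse (k := k) (n := n)
  refine Subquot.dim_le_card _ _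
    (LinearMap.pi fun m : specialExp a (l + 1) d =>
      (Finsupp.lapply (R := k) m.1 ∘ₗ (AddMonoidAlgebra.coeffLinearEquiv k).toLinearMap ∘ₗ g ∘ₗ
        LinearMap.proj (basePt (neg m.1))) ∘ₗ Submodule.subtype _) ?_
  rintro ⟨α, hα, hd⟩ h
  exact exists_of_diff_eq_zero hz a hα hd g hg fun m hm => congrFun h ⟨m, hm⟩

end Segre
end

noncomputable section

open AltSign CechVec PairCech CechLocal

namespace Segre

variable {k : Type u} [Field k] {n : ℕ} {z : Fin (n + 1) → T k n}

/-! ### The twisted Segre product -/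

/-- The shifts `0, q, …, (n - 1) q`. -/
def shift (n q : ℕ) (i : Fin n) : ℤ := (i : ℤ) * q

theorem shift_nonneg (q : ℕ) (i : Fin n) : 0 ≤ shift n q i := by
  unfold shift; positivity

theorem WIncl_injective (q : ℕ) : Function.Injective (WIncl k n q) := Subtype.val_injective

theorem gens_smul_mem (hz : ∀ i, (z i : Poly k n) ∈ piece k (0 : Fin n → ℤ) 1) (q : ℕ)
    (i : Fin (n + 1)) (d : ℤ) (w : W k n q) (hw : w ∈ WPiece k n q d) :
    gens z i • w ∈ WPiece k n q (d + 1) := by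
  have := mul_mem_piece (hz i) hw
  rw [zero_add, add_comm] at this
  exact this

/-- The projections of `W_q^n` onto its graded parts. -/
def WProj (hn : 0 < n) (q : ℕ) : GradedProj (WPiece k n q) where
  π d := LinearMap.codRestrict (total k fun i : Fin n => (i : ℤ) * q)
    (proj k (shift n q) d ∘ₗ WIncl k n q) fun w => piece_le_total _ d (proj_mem _ _ _)
  mem d w := proj_mem _ _ _
  self d w hw := WIncl_injective q (proj_self hw)
  ne d e w hw h := WIncl_injective q (proj_ne hn hw h)
  exists_sum w := by
    obtain ⟨F, hF⟩ := exists_sum_proj hn w.2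
    refine ⟨F, WIncl_injective q ?_⟩
    rw [map_sum]
    exact hF

variable (hz : ∀ i, (z i : Poly k n) ∈ piece k (0 : Fin n → ℤ) 1) (q : ℕ)

variable (hn : 0 < n) (hfin : Module.Finite (A z) (T k n))

/-- The inclusion of `W_q^n` into the field of rational functions. -/
def WEmb : FieldEmbedding (k := k) (A := A z) (M := W k n q) (Frac k n) (gens z) (WPiece k n q) where
  map :=
    { toFun := fun w => toFrac k n (toLaurent k n (WIncl k n q w))
      map_add' := fun w w' => by simp
      map_smul' := fun c w => by
        have h : WIncl k n q (c • w) = ((c : T k n) : Poly k n) * WIncl k n q w := rfl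
        rw [h, map_mul, map_mul, RingHom.id_apply, Algebra.smul_def, algebraMap_frac] }
  injective := fun w w' h =>
    WIncl_injective q (toLaurent_injective (toFrac_injective h))
  ne_zero := zeta_ne_zero hn hfin
  smul_mem := gens_smul_mem hz q

/-- The image of `W_q^n` in the field of rational functions. -/
abbrev wFam : Fam k (Frac k n) (zeta z) := (WEmb hz q hn hfin).fam

theorem mem_wFam {d : ℤ} {f : Frac k n} :
    f ∈ (wFam hz q hn hfin).gr d ↔ f ∈ fPiece k (fun _ => False) (shift n q) d := by
  constructor
  · rintro ⟨w, hw, rfl⟩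
    exact ⟨_, toLaurent_mem_lPiece hw, rfl⟩
  · rintro ⟨f, hf, rfl⟩
    obtain ⟨g, hg, rfl⟩ := exists_toLaurent_eq hf
    exact ⟨(⟨g, piece_le_total _ d hg⟩ : total k fun i : Fin n => (i : ℤ) * q), hg, rfl⟩

/-! ### Comparison of `W_q^n` with the cocycles in degree zero -/

/-- The augmentation of the double complex. -/
def diag (k : Type u) [Field k] (n : ℕ) : Frac k n →ₗ[Frac k n] (Ix n → Frac k n) :=
  LinearMap.pi fun τ => if (both τ).card = 0 then LinearMap.id else 0

theorem diag_apply (v : Frac k n) (τ : Ix n) :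
    diag k n v τ = if (both τ).card = 0 then v else 0 := by
  unfold diag
  rw [LinearMap.pi_apply]
  split_ifs <;> rfl

theorem diff_diag (v : Frac k n) : PairCech.diff (Frac k n) n (Frac k n) (diag k n v) = 0 := by
  funext τ
  rw [PairCech.diff_apply]
  refine Finset.sum_eq_zero fun i _ => ?_
  rw [edge, diag_apply, diag_apply, both_update_some, both_update_some, sub_self, smul_zero]

/-- The term in degree zero. -/
abbrev zFam : Fam k (Ix n → Frac k n) (zeta z) :=
  (dComplex hz (shift n q) (shift_nonneg q) hn hfin).Z 0

theorem diag_mem {d : ℤ} {v : Frac k n} (hv : v ∈ (wFam hz q hn hfin).gr d) :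
    diag k n v ∈ (zFam hz q hn hfin).gr d := by
  refine ⟨fun τ => ⟨fun h => ?_, fun h => ?_⟩, diff_diag v⟩
  · rw [diag_apply, if_pos h]
    exact fPiece_mono (fun _ h => h.elim) _ _ ((mem_wFam hz q hn hfin).1 hv)
  · rw [diag_apply, if_neg h]

/-- Gluing on the charts: at the index inverting all x_i only the exponents of x_i could be
negative. The cocycle condition identifies this value with the one on the chart that inverts y_i
instead of x_i, where the exponent of x_i is nonnegative. -/
theorem eval_mem {d : ℤ} {α : Ix n → Frac k n} (hα : α ∈ (zFam hz q hn hfin).gr d) :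
    α (fun _ => some 0) ∈ (wFam hz q hn hfin).gr d := by
  obtain ⟨hα, hd⟩ := hα
  change PairCech.diff (Frac k n) n (Frac k n) α = 0 at hd
  have hb : ∀ τ : Ix n, (∀ i, τ i ≠ none) → (both τ).card = 0 := by
    intro τ h
    rw [Finset.card_eq_zero, Finset.eq_empty_iff_forall_notMem]
    exact fun i hi => h i (mem_both.1 hi)
  rw [mem_wFam]
  obtain ⟨f, hf, hfα⟩ := (hα fun _ => some 0).1 (hb _ (by simp))
  refine ⟨f, mem_lPiece.2 fun m hm => ⟨?_, (mem_lPiece.1 hf m hm).2⟩, hfα⟩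
  rintro ⟨i, b⟩ -
  have hupd : ∀ c : Fin 2, ∀ l, (Function.update (fun _ => some 0) i (some c) : Ix n) l ≠ none := by
    intro c l
    by_cases hl : l = i
    · subst hl; simp
    · simp [hl]
  have h1 : α (Function.update (fun _ => some 0) i (some 1)) = α fun _ => some 0 := by
    have h := congrFun hd (Function.update (fun _ => some 0) i none)
    rw [PairCech.diff_apply, both_update_none, Finset.card_eq_zero.1 (hb (fun _ => some 0) (by simp)),
      Finset.insert_empty, Finset.sum_singleton, edge, Function.update_idem, Function.update_idem,
      Pi.zero_apply] at h
    have h' := congrArg (fun x => sgn {i} i • x) h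
    simp only [smul_smul, sgn_mul_self, one_smul, smul_zero] at h'
    rw [sub_eq_zero.1 h']
    congr 1
    funext l
    by_cases hl : l = i
    · subst hl; simp
    · simp [hl]
  obtain ⟨g, hg, hgα⟩ := (hα (Function.update (fun _ => some 0) i (some 1))).1 (hb _ (hupd 1))
  have hfg : g = f := toFrac_injective (hgα.trans (h1.trans hfα.symm))
  subst hfg
  by_cases hb0 : b = 0
  · subst hb0
    exact (mem_lPiece.1 hg m hm).1 (i, 0) (by simp [inv])
  · exact (mem_lPiece.1 hf m hm).1 (i, b) (by simp [inv, eq_comm, hb0])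

/-- Evaluation at one chart is a left inverse of `diag`, and both maps are linear over the field and
preserve degrees, so the cohomology of W_q^n injects into that of the degree-zero cocycles. -/
theorem hdim_wFam_le (j d : ℤ) :
    (wFam hz q hn hfin).hdim j d ≤ (zFam hz q hn hfin).hdim j d := by
  refine Subquot.dim_le_dim_of_rel _ _ _ _
    (LinearMap.graph (((diag k n).restrictScalars k).compLeft (Finset (Fin (n + 1))))) ?_ ?_
  · intro α hα
    obtain ⟨hα, hδ⟩ := Fam.mem_cocyc.1 hα
    refine ⟨fun S => diag k n (α S), Fam.mem_cocyc.2 ⟨fun S => ⟨fun hS => ?_, fun hS => ?_⟩, ?_⟩, rfl⟩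
    · exact Fam.loc_le_of_map _ _ (diag k n) (fun d v hv => diag_mem hz q hn hfin hv) ((hα S).1 hS)
    · exact (congrArg (diag k n) ((hα S).2 hS)).trans (map_zero _)
    · refine (delta_comp ((diag k n).restrictScalars k) α).trans ?_
      rw [hδ]
      funext S
      simp
  · intro α β _ _ hβ ⟨η, hη, h⟩
    change β = fun S => diag k n (α S) at hβ
    subst hβ
    let ev : (Ix n → Frac k n) →ₗ[Frac k n] Frac k n := LinearMap.proj fun _ => some 0
    refine ⟨fun S => ev (η S), fun S => ⟨fun hS => ?_, fun hS => ?_⟩, ?_⟩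
    · exact Fam.loc_le_of_map _ _ ev (fun d v hv => eval_mem hz q hn hfin hv) ((hη S).1 hS)
    · exact (congrArg ev ((hη S).2 hS)).trans (map_zero _)
    · refine (delta_comp (ev.restrictScalars k) η).trans ?_
      rw [h]
      funext S
      change diag k n (α S) _ = _
      rw [diag_apply, if_pos]
      rw [Finset.card_eq_zero, Finset.eq_empty_iff_forall_notMem]
      intro i hi
      simp [mem_both] at hi

theorem rank_HWPiece_zero (hz : ∀ i, (z i : Poly k n) ∈ piece k (0 : Fin n → ℤ) 1) (q : ℕ)
    (hn : 0 < n) (hfin : Module.Finite (A z) (T k n)) (d : ℤ) :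
    Module.rank k (HWPiece z q 0 d) = 0 :=
  (WEmb hz q hn hfin).rank_zero (Nat.succ_pos n) d

theorem rank_HWPiece_le_hdim_zFam (j : ℕ) (d : ℤ) :
    Module.rank k (HWPiece z q j d) ≤ (zFam hz q hn hfin).hdim j d :=
  ((WEmb hz q hn hfin).rank_le j d).trans (hdim_wFam_le hz q hn hfin j d)

theorem rank_HWPiece_one (hz : ∀ i, (z i : Poly k n) ∈ piece k (0 : Fin n → ℤ) 1) (q : ℕ)
    (hn : 0 < n) (hfin : Module.Finite (A z) (T k n)) (d : ℤ) :
    Module.rank k (HWPiece z q 1 d) = 0 := by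
  refine le_antisymm ((rank_HWPiece_le_hdim_zFam hz q hn hfin 1 d).trans_eq ?_) zero_le
  exact AcyclicComplex.hdim_Z_one _ (zeta_ne_zero hn hfin) 0 d (Nat.succ_pos n)

theorem rank_HWPiece_le (hz : ∀ i, (z i : Poly k n) ∈ piece k (0 : Fin n → ℤ) 1) (q : ℕ)
    (hn : 0 < n) (hfin : Module.Finite (A z) (T k n)) (l : ℕ) (d : ℤ)
    [Fintype (specialExp (shift n q) (l + 1) d)] :
    Module.rank k (HWPiece z q (l + 2) d) ≤ Fintype.card (specialExp (shift n q) (l + 1) d) := by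
  refine (rank_HWPiece_le_hdim_zFam hz q hn hfin (l + 2) d).trans ?_
  have h := (dComplex hz (shift n q) (shift_nonneg q) hn hfin).hdim_Z_le
    (zeta_ne_zero hn hfin) l 0 d (Nat.succ_pos n)
  rw [Nat.zero_add] at h
  exact h.trans (dim_dComplex_le hz (shift n q) (shift_nonneg q) hn hfin l d)

theorem iSup_HWPiece (hz : ∀ i, (z i : Poly k n) ∈ piece k (0 : Fin n → ℤ) 1) (q : ℕ)
    (hn : 0 < n) (hfin : Module.Finite (A z) (T k n)) (j : ℕ) : ⨆ d, HWPiece z q j d = ⊤ :=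
  (WEmb hz q hn hfin).iSup_eq_top (WProj hn q) j

end Segre
end

noncomputable section

open AltSign CechVec PairCech CechLocal

namespace Segre

/-! ### Counting exponents -/

theorem specialExp_signs {n : ℕ} {a : Fin n → ℤ} {l : ℕ} {d : ℤ} {m : Fin n × Fin 2 → ℤ}
    (hm : m ∈ specialExp a l d) (i : Fin n) :
    (0 ≤ m (i, 0) ∧ 0 ≤ m (i, 1) ∧ m (i, 0) + m (i, 1) = d + a i) ∨
      (m (i, 0) < 0 ∧ m (i, 1) < 0 ∧ m (i, 0) + m (i, 1) = d + a i) := by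
  have h1 := hm.1 i
  have h2 := hm.2.1 i
  by_cases h : m (i, 0) < 0
  · exact Or.inr ⟨h, h2.1 h, h1⟩
  · exact Or.inl ⟨not_lt.1 h, not_lt.1 fun h' => h (h2.2 h'), h1⟩

theorem mem_full_neg {n : ℕ} {a : Fin n → ℤ} {l : ℕ} {d : ℤ} {m : Fin n × Fin 2 → ℤ}
    (hm : m ∈ specialExp a l d) (i : Fin n) : i ∈ full (neg m) ↔ d + a i < 0 := by
  have := specialExp_signs hm i
  simp only [full, Finset.mem_filter, Finset.mem_univ, true_and]
  omega

/-- An exponent is determined by the numbers m (i, 0). Their signs are forced by d + a i and their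
absolute values are at most |d + a i|, so recording absolute values loses nothing. -/
theorem exists_card_specialExp_le {n : ℕ} (a : Fin n → ℤ) (l : ℕ) (d : ℤ) (c : Fin n → ℕ)
    (hc : ∀ i, (d + a i).natAbs < c i) :
    ∃ _ : Fintype (specialExp a l d), Fintype.card (specialExp a l d) ≤ ∏ i, c i := by
  let g : specialExp a l d → ∀ i, Fin (c i) := fun m i => ⟨(m.1 (i, 0)).natAbs, by
    have h1 := specialExp_signs m.2 i
    have h2 := hc i
    omega⟩
  have hg : Function.Injective g := by
    intro m m' h
    have key : ∀ i, m.1 (i, 0) = m'.1 (i, 0) ∧ m.1 (i, 1) = m'.1 (i, 1) := by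
      intro i
      have h1 := specialExp_signs m.2 i
      have h2 := specialExp_signs m'.2 i
      have h3 : (m.1 (i, 0)).natAbs = (m'.1 (i, 0)).natAbs := congrArg Fin.val (congrFun h i)
      omega
    refine Subtype.ext (funext ?_)
    rintro ⟨i, b⟩
    fin_cases b
    · exact (key i).1
    · exact (key i).2
  let inst : Fintype (specialExp a l d) := Fintype.ofInjective g hg
  refine ⟨inst, (Fintype.card_le_of_injective g hg).trans_eq ?_⟩
  simp

/-- The l + 1 negative pairs are those with d + iq < 0, an initial segment, so index l belongs to it
and index l + 1, if it exists, does not. The bound -2 rather than -1 appears because two negative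
exponents sum to at most -2. -/
theorem specialExp_shift_bounds {n q l : ℕ} {d : ℤ} {m : Fin n × Fin 2 → ℤ}
    (hm : m ∈ specialExp (shift n q) (l + 1) d) :
    d + l * q ≤ -2 ∧ (l + 1 < n → 0 ≤ d + (l + 1) * q) := by
  have hcard := hm.2.2
  constructor
  · by_contra h
    have hsub : (full (neg m)).card ≤ (Finset.range l).card := by
      refine Finset.card_le_card_of_injOn (fun i => i.1) ?_ fun i _ j _ h => Fin.ext h
      intro i hi
      have h1 := specialExp_signs hm i
      have h2 := (mem_full_neg hm i).1 hi
      simp only [shift] at h1 h2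
      refine Finset.mem_coe.2 (Finset.mem_range.2 (lt_of_not_ge fun hil => h ?_))
      have : (l : ℤ) * q ≤ (i : ℤ) * q :=
        mul_le_mul_of_nonneg_right (by exact_mod_cast hil) (Nat.cast_nonneg q)
      omega
    rw [Finset.card_range] at hsub
    omega
  · intro hl
    by_contra h
    have hsub : (Finset.univ : Finset (Fin (l + 2))).card ≤ (full (neg m)).card := by
      refine Finset.card_le_card_of_injOn (Fin.castLE hl) ?_ (Fin.castLE_injective hl).injOn
      intro i _
      refine Finset.mem_coe.2 ((mem_full_neg hm _).2 ?_)
      have : (i : ℤ) * q ≤ ((l : ℤ) + 1) * q :=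
        mul_le_mul_of_nonneg_right (by have := i.2; omega) (Nat.cast_nonneg q)
      simp only [shift, Fin.val_castLE]
      omega
    rw [Finset.card_fin] at hsub
    omega

/-! ### Vanishing and dimension bounds -/

/-- Graded spaces `M j`, `j ≥ 0`, that vanish for `j ≤ 1` and are bounded by the number of
exponents for `j ≥ 2`. -/
structure BoundedByExp {k : Type u} [Field k] (n q : ℕ) {M : ℕ → Type u}
    [∀ j, AddCommGroup (M j)] [∀ j, Module k (M j)] (H : ∀ j, ℤ → Submodule k (M j)) : Prop where
  zero : ∀ d, Module.rank k (H 0 d) = 0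
  one : ∀ d, Module.rank k (H 1 d) = 0
  le : ∀ (l : ℕ) (d : ℤ) [Fintype (specialExp (shift n q) (l + 1) d)],
    Module.rank k (H (l + 2) d) ≤ Fintype.card (specialExp (shift n q) (l + 1) d)
  iSup_eq_top : ∀ j, ⨆ d, H j d = ⊤

theorem modPiece_eq_sup {k M : Type u} [Field k] [AddCommGroup M] [Module k M]
    {H : ℤ → Submodule k M} {a q : ℤ} (s : Finset ℤ) (h : ∀ i, H (a + i * q) ≠ ⊥ → i ∈ s) :
    modPiece H a q = s.sup fun i => H (a + i * q) := by
  refine le_antisymm (iSup_le fun i => ?_) (Finset.sup_le fun i _ => le_iSup (fun i =>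
    H (a + i * q)) i)
  by_cases hi : H (a + i * q) = ⊥
  · rw [hi]
    exact bot_le
  · exact Finset.le_sup (f := fun i => H (a + i * q)) (h i hi)

theorem sitsInDegrees_of_iSup_eq_top {k M : Type u} [Field k] [AddCommGroup M] [Module k M]
    {H : ℤ → Submodule k M} {D : Set ℤ} (hD : ∀ d, H d ≠ ⊥ → d ∈ D) (hH : ⨆ d, H d = ⊤) :
    SitsInDegrees H D := by
  have h : ∀ d ∉ D, H d = ⊥ := fun d hd => by_contra fun h => hd (hD d h)
  refine ⟨h, eq_top_iff.2 (hH.symm.trans_le (iSup_le fun d => ?_))⟩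
  by_cases hd : d ∈ D
  · exact le_iSup₂_of_le d hd le_rfl
  · rw [h d hd]
    exact bot_le

namespace BoundedByExp

variable {k : Type u} [Field k] {n q : ℕ} {M : ℕ → Type u} [∀ j, AddCommGroup (M j)]
  [∀ j, Module k (M j)] {H : ∀ j, ℤ → Submodule k (M j)}

theorem eq_bot (B : BoundedByExp n q H) {j : ℕ} (hj : j ≤ 1) (d : ℤ) : H j d = ⊥ := by
  rw [← Submodule.rank_eq_zero]
  interval_cases j
  · exact B.zero d
  · exact B.one d

theorem bounds (B : BoundedByExp n q H) {l : ℕ} {d : ℤ} (h : H (l + 2) d ≠ ⊥) :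
    d + l * q ≤ -2 ∧ (l + 1 < n → 0 ≤ d + (l + 1) * q) := by
  by_contra hb
  have : IsEmpty (specialExp (shift n q) (l + 1) d) :=
    ⟨fun m => hb (specialExp_shift_bounds m.2)⟩
  have : Fintype (specialExp (shift n q) (l + 1) d) := Fintype.ofIsEmpty
  refine h (Submodule.rank_eq_zero.1 (le_antisymm ((B.le l d).trans_eq ?_) zero_le))
  rw [Fintype.card_eq_zero, Nat.cast_zero]

theorem finrank_le (B : BoundedByExp n q H) (l : ℕ) (d : ℤ) (c : Fin n → ℕ)
    (hc : ∀ i, (d + shift n q i).natAbs < c i) :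
    Module.Finite k (H (l + 2) d) ∧ Module.finrank k (H (l + 2) d) ≤ ∏ i, c i := by
  obtain ⟨_, h⟩ := exists_card_specialExp_le (shift n q) (l + 1) d c hc
  have h' : Module.rank k (H (l + 2) d) ≤ ((∏ i, c i : ℕ) : Cardinal) :=
    (B.le l d).trans (by exact_mod_cast h)
  exact ⟨Module.rank_lt_aleph0_iff.1 (h'.trans_lt Cardinal.natCast_lt_aleph0),
    Module.finrank_le_of_rank_le h'⟩

theorem finite (B : BoundedByExp n q H) (l : ℕ) (d : ℤ) : Module.Finite k (H (l + 2) d) :=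
  (B.finrank_le l d _ fun _ => Nat.lt_succ_self _).1

/-- In this degree the pair of index l has total degree -r, independent of q, so only the other n -
1 factors grow with q. -/
theorem finrank_le_of_index (B : BoundedByExp n q H) (hq : 0 < q) {l : ℕ} (hl : l < n) (r : ℤ)
    {d : ℤ}
    (hd : d = -(l * q) - r) : Module.finrank k (H (l + 2) d) ≤
      (r.natAbs + 1) * (n + r.natAbs + 1) ^ (n - 1) * q ^ (n - 1) := by
  subst hd
  refine (B.finrank_le l _
    (fun i => if i = ⟨l, hl⟩ then r.natAbs + 1 else (n + r.natAbs + 1) * q) fun i => ?_).2.trans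
    (le_of_eq ?_)
  · have e : -((l : ℤ) * q) - r + shift n q i = ((i : ℤ) - l) * q - r := by
      unfold shift; ring
    rw [e]
    split_ifs with h
    · subst h
      simp
    · have h1 : (((i : ℤ) - l) * q).natAbs ≤ n * q := by
        rw [Int.natAbs_mul, Int.natAbs_natCast]
        exact Nat.mul_le_mul_right _ (by have := i.2; omega)
      have h2 : r.natAbs + 1 ≤ (r.natAbs + 1) * q := Nat.le_mul_of_pos_right _ hq
      have h3 : (n + r.natAbs + 1) * q = n * q + (r.natAbs + 1) * q := by ring
      omega
  · rw [← Finset.mul_prod_erase Finset.univ _ (Finset.mem_univ (⟨l, hl⟩ : Fin n)), if_pos rfl,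
      Finset.prod_congr rfl fun i hi => if_neg (Finset.ne_of_mem_erase hi), Finset.prod_const,
      Finset.card_erase_of_mem (Finset.mem_univ _), Finset.card_fin, mul_pow, mul_assoc]

theorem finrank_le_pow (B : BoundedByExp n q H) (hq : 0 < q) (l t : ℕ) (r : ℤ) {d : ℤ}
    (hd : d = -((n + t) * q) - r) : Module.finrank k (H (l + 2) d) ≤
      (2 * n + t + r.natAbs + 1) ^ n * q ^ n := by
  subst hd
  refine (B.finrank_le l _
    (fun _ => (2 * n + t + r.natAbs + 1) * q) fun i => ?_).2.trans (le_of_eq ?_)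
  · have e : -(((n : ℤ) + t) * q) - r + shift n q i = ((i : ℤ) - n - t) * q - r := by
      unfold shift; ring
    rw [e]
    have h1 : (((i : ℤ) - n - t) * q).natAbs ≤ (n + t) * q := by
      rw [Int.natAbs_mul, Int.natAbs_natCast]
      exact Nat.mul_le_mul_right _ (by have := i.2; omega)
    have h2 : r.natAbs + 1 ≤ (r.natAbs + 1) * q := Nat.le_mul_of_pos_right _ hq
    have h3 : (2 * n + t + r.natAbs + 1) * q = n * q + (n + t) * q + (r.natAbs + 1) * q := by ring
    omega
  · rw [Finset.prod_const, Finset.card_fin, mul_pow]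

theorem modPiece_eq_bot (B : BoundedByExp n q H) {j : ℕ} (hj : j ≤ 1) (a b : ℤ) : modPiece
    (H j) a b = ⊥ := by
  rw [modPiece_eq_sup ∅ fun i hi => absurd (B.eq_bot hj _) hi, Finset.sup_empty]

/-- The nonzero degrees satisfy -(l+1)q ≤ d < -lq. Substituting d = -r + iq leaves only the i with i
+ l ≥ 0 and (i + l)q < r. -/
theorem mod_bounds (B : BoundedByExp n q H) {l : ℕ} (hl : l + 1 < n) {r : ℤ} (hr : 0 < r) {i : ℤ}
    (hi : H (l + 2) (-r + i * q) ≠ ⊥) : 0 ≤ i + l ∧ (i + l) * q < r := by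
  obtain ⟨h1, h2⟩ := B.bounds hi
  have h2 := h2 hl
  have h3 : 0 < (i + l + 1) * q := by linarith
  have h4 := pos_of_mul_pos_left h3 (Nat.cast_nonneg q)
  exact ⟨by omega, by linarith⟩

theorem finite_modPiece (B : BoundedByExp n q H) (hq : 0 < q) {l : ℕ} (hl : l + 1 < n) {r : ℤ}
    (hr : 0 < r) {b : ℤ}
    (hb : b = q) : Module.Finite k (modPiece (H (l + 2)) (-r) b) := by
  subst hb
  rw [modPiece_eq_sup (Finset.Icc (-(l : ℤ)) (r - l)) fun i hi => ?_]
  · have := fun i : ℤ => B.finite l (-r + i * q)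
    exact Submodule.finite_finset_sup _ _
  · obtain ⟨h1, h2⟩ := B.mod_bounds hl hr hi
    have h3 : i + l ≤ (i + l) * q := le_mul_of_one_le_right h1 (by exact_mod_cast hq)
    rw [Finset.mem_Icc]
    omega

/-- Once q ≥ r, the inequality (i + l)q < r leaves only i = -l. -/
theorem modPiece_eq (B : BoundedByExp n q H) {l : ℕ} (hl : l + 1 < n) {r : ℤ} (hr : 0 < r)
    (hqr : r ≤ q) {b : ℤ}
    (hb : b = q) : modPiece (H (l + 2)) (-r) b = H (l + 2) (-(l * q) - r) := by
  subst hb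
  rw [modPiece_eq_sup {-(l : ℤ)} fun i hi => ?_, Finset.sup_singleton]
  · congr 1
    ring
  · obtain ⟨h1, h2⟩ := B.mod_bounds hl hr hi
    rw [Finset.mem_singleton]
    by_contra h
    have h3 : (q : ℤ) ≤ (i + l) * q :=
      le_mul_of_one_le_left (Nat.cast_nonneg q) (by omega)
    omega

end BoundedByExp

/-! ### Asymptotics in `q = p ^ e` and assembly of the four claims -/

open Filter Asymptotics in
theorem isLittleO_pow_of_eventually_le {p : ℕ} (hp : 1 < p) {f : ℕ → ℕ} (C : ℕ) {m n : ℕ}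
    (hmn : m < n) (h : ∀ᶠ e in atTop, f e ≤ C * (p ^ e) ^ m) :
    (fun e => (f e : ℝ)) =o[atTop] fun e : ℕ => ((p : ℝ) ^ e) ^ n := by
  have h1 : (fun e => (f e : ℝ)) =O[atTop] fun e : ℕ => ((p : ℝ) ^ e) ^ m := by
    refine IsBigO.of_bound C (h.mono fun e he => ?_)
    rw [Real.norm_of_nonneg (Nat.cast_nonneg _), Real.norm_of_nonneg (by positivity)]
    exact_mod_cast he
  refine h1.trans_isLittleO ?_
  exact (isLittleO_pow_pow_atTop_of_lt (𝕜 := ℝ) hmn).comp_tendsto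
    (tendsto_pow_atTop_atTop_of_one_lt (by exact_mod_cast hp))

open Filter Asymptotics in
theorem BoundedByExp.main {k : Type u} [Field k] {p n : ℕ} (hp : 1 < p) (hn : 0 < n)
    {M : ℕ → ℕ → Type u} {_ : ∀ q j, AddCommGroup (M q j)} {_ : ∀ q j, Module k (M q j)}
    {H : ∀ q j, ℤ → Submodule k (M q j)} (B : ∀ q, BoundedByExp n q (H q)) :
    (∀ e j : ℕ, 2 ≤ j → j ≤ n →
      SitsInDegrees (H (p ^ e) j)
        (Set.Icc (-((j : ℤ) - 1) * (p : ℤ) ^ e) (-((j : ℤ) - 2) * (p : ℤ) ^ e - 2))) ∧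
    (∀ e : ℕ,
      SitsInDegrees (H (p ^ e) (n + 1))
        (Set.Iic (-((n : ℤ) - 1) * (p : ℤ) ^ e - 2))) ∧
    (∀ r : ℤ, 0 < r →
      (∀ j : ℕ, 2 ≤ j → j ≤ n + 1 →
        (∀ e : ℕ, Module.Finite k (H (p ^ e) j (-((j : ℤ) - 2) * (p : ℤ) ^ e - r))) ∧
        (fun e : ℕ => (Module.finrank k
            (H (p ^ e) j (-((j : ℤ) - 2) * (p : ℤ) ^ e - r)) : ℝ))
          =o[atTop] fun e : ℕ => ((p : ℝ) ^ e) ^ n) ∧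
      (∀ t : ℕ,
        (∀ e : ℕ, Module.Finite k
          (H (p ^ e) (n + 1) (-((n : ℤ) + t) * (p : ℤ) ^ e - r))) ∧
        (fun e : ℕ => (Module.finrank k
            (H (p ^ e) (n + 1) (-((n : ℤ) + t) * (p : ℤ) ^ e - r)) : ℝ))
          =o[atTop] fun e : ℕ => ((p : ℝ) ^ e) ^ (n + 1))) ∧
    (∀ r : ℤ, 0 < r → ∀ j : ℕ, j ≤ n →
      (∀ e : ℕ, Module.Finite k (modPiece (H (p ^ e) j) (-r) ((p : ℤ) ^ e))) ∧
      (fun e : ℕ => (Module.finrank k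
          (modPiece (H (p ^ e) j) (-r) ((p : ℤ) ^ e)) : ℝ))
        =o[atTop] fun e : ℕ => ((p : ℝ) ^ e) ^ n) := by
  have hq : ∀ e, 0 < p ^ e := fun e => pow_pos (by omega) e
  have hcast : ∀ e, (p : ℤ) ^ e = ((p ^ e : ℕ) : ℤ) := fun e => (Nat.cast_pow p e).symm
  obtain ⟨n, rfl⟩ : ∃ n', n = n' + 1 := ⟨n - 1, by omega⟩
  have hdeg : ∀ (l e : ℕ) (r : ℤ), -(((l + 2 : ℕ) : ℤ) - 2) * (p : ℤ) ^ e - r =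
      -(l * ((p ^ e : ℕ) : ℤ)) - r := by
    intro l e r
    push_cast
    ring
  refine ⟨fun e j hj hjn => ?_, fun e => ?_, fun r hr => ⟨fun j hj hjn => ?_, fun t => ?_⟩,
    fun r hr j hjn => ?_⟩
  · obtain ⟨l, rfl⟩ : ∃ l, j = l + 2 := ⟨j - 2, by omega⟩
    refine sitsInDegrees_of_iSup_eq_top (fun d hd => ?_) ((B _).iSup_eq_top _)
    obtain ⟨h1, h2⟩ := (B _).bounds hd
    have h2 := h2 (by omega)
    rw [Set.mem_Icc, hcast, Nat.cast_add, Nat.cast_ofNat]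
    exact ⟨by linarith, by linarith⟩
  · refine sitsInDegrees_of_iSup_eq_top (fun d hd => ?_) ((B _).iSup_eq_top _)
    obtain ⟨h1, -⟩ := (B _).bounds hd
    rw [Set.mem_Iic, hcast, Nat.cast_succ]
    linarith
  · obtain ⟨l, rfl⟩ : ∃ l, j = l + 2 := ⟨j - 2, by omega⟩
    exact ⟨fun e => (B _).finite l _, isLittleO_pow_of_eventually_le hp _ (Nat.lt_succ_self n)
      (.of_forall fun e => (B _).finrank_le_of_index (hq e) (by omega) r (hdeg l e r))⟩
  · exact ⟨fun e => (B _).finite n _, isLittleO_pow_of_eventually_le hp _ (Nat.lt_succ_self _)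
      (.of_forall fun e => (B _).finrank_le_pow (hq e) n t r (by rw [hcast, neg_mul]))⟩
  · rcases Nat.lt_or_ge j 2 with hj | hj
    · have h := fun e => (B (p ^ e)).modPiece_eq_bot (Nat.lt_succ_iff.1 hj) (-r) ((p : ℤ) ^ e)
      refine ⟨fun e => by rw [h e]; infer_instance, ?_⟩
      refine isLittleO_pow_of_eventually_le hp 0 (Nat.lt_succ_self n) (.of_forall fun e => ?_)
      rw [h e, finrank_bot]
      exact Nat.zero_le _
    · obtain ⟨l, rfl⟩ : ∃ l, j = l + 2 := ⟨j - 2, by omega⟩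
      refine ⟨fun e => (B _).finite_modPiece (hq e) (by omega) hr (hcast e),
        isLittleO_pow_of_eventually_le hp
          ((r.natAbs + 1) * (n + 1 + r.natAbs + 1) ^ (n + 1 - 1)) (Nat.lt_succ_self n) ?_⟩
      -- The reduction to one degree needs p ^ e ≥ r, which suffices for the asymptotic bound;
      -- finiteness for every e was obtained separately.
      filter_upwards [(tendsto_pow_atTop_atTop_of_one_lt hp).eventually_ge_atTop r.toNat]
        with e he
      rw [(B _).modPiece_eq (by omega) hr (by omega) (hcast e)]
      exact (B _).finrank_le_of_index (hq e) (by omega) r rfl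

open Filter Asymptotics CechLocal in
theorem degrees_and_growth_of_HPiece {k A : Type u} [Field k] [CommRing A] [Algebra k A]
    {M : ℕ → Type u}
    [∀ q, AddCommGroup (M q)] [∀ q, Module A (M q)] [∀ q, Module k (M q)]
    [∀ q, IsScalarTower k A (M q)] {N : ℕ} {z : Fin N → A} {ℳ : ∀ q, ℤ → Submodule k (M q)}
    {p n : ℕ} (hp : 1 < p) (hn : 0 < n)
    (h0 : ∀ q d, Module.rank k (HPiece k z (ℳ q) 0 d) = 0)
    (h1 : ∀ q d, Module.rank k (HPiece k z (ℳ q) 1 d) = 0)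
    (h2 : ∀ (q l : ℕ) (d : ℤ) [Fintype (specialExp (shift n q) (l + 1) d)],
      Module.rank k (HPiece k z (ℳ q) (l + 2) d) ≤
        Fintype.card (specialExp (shift n q) (l + 1) d))
    (htop : ∀ q j, ⨆ d, HPiece k z (ℳ q) j d = ⊤) :
    (∀ e j : ℕ, 2 ≤ j → j ≤ n →
      SitsInDegrees (HPiece k z (ℳ (p ^ e)) j)
        (Set.Icc (-((j : ℤ) - 1) * (p : ℤ) ^ e) (-((j : ℤ) - 2) * (p : ℤ) ^ e - 2))) ∧
    (∀ e : ℕ,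
      SitsInDegrees (HPiece k z (ℳ (p ^ e)) (n + 1))
        (Set.Iic (-((n : ℤ) - 1) * (p : ℤ) ^ e - 2))) ∧
    (∀ r : ℤ, 0 < r →
      (∀ j : ℕ, 2 ≤ j → j ≤ n + 1 →
        (∀ e : ℕ, Module.Finite k (HPiece k z (ℳ (p ^ e)) j (-((j : ℤ) - 2) * (p : ℤ) ^ e - r))) ∧
        (fun e : ℕ => (Module.finrank k
            (HPiece k z (ℳ (p ^ e)) j (-((j : ℤ) - 2) * (p : ℤ) ^ e - r)) : ℝ))
          =o[atTop] fun e : ℕ => ((p : ℝ) ^ e) ^ n) ∧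
      (∀ t : ℕ,
        (∀ e : ℕ, Module.Finite k
          (HPiece k z (ℳ (p ^ e)) (n + 1) (-((n : ℤ) + t) * (p : ℤ) ^ e - r))) ∧
        (fun e : ℕ => (Module.finrank k
            (HPiece k z (ℳ (p ^ e)) (n + 1) (-((n : ℤ) + t) * (p : ℤ) ^ e - r)) : ℝ))
          =o[atTop] fun e : ℕ => ((p : ℝ) ^ e) ^ (n + 1))) ∧
    (∀ r : ℤ, 0 < r → ∀ j : ℕ, j ≤ n →
      (∀ e : ℕ, Module.Finite k (modPiece (HPiece k z (ℳ (p ^ e)) j) (-r) ((p : ℤ) ^ e))) ∧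
      (fun e : ℕ => (Module.finrank k
          (modPiece (HPiece k z (ℳ (p ^ e)) j) (-r) ((p : ℤ) ^ e)) : ℝ))
        =o[atTop] fun e : ℕ => ((p : ℝ) ^ e) ^ n) :=
  BoundedByExp.main (M := fun q j => H z (M q) j) (H := fun q j => HPiece k z (ℳ q) j) hp hn
    fun q => ⟨h0 q, h1 q, fun l d _ => h2 q l d, htop q⟩

end Segre
end

open Segre Filter Asymptotics in
theorem mainTheorem7 {k : Type*} [Field k] [Infinite k] (p : ℕ) [Fact p.Prime] [CharP k p]
    (n : ℕ) (hn : 1 ≤ n)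
    (z : Fin (n + 1) → T k n)
    (hz : ∀ i, (z i : Poly k n) ∈ piece k (0 : Fin n → ℤ) 1)
    (hfin : Module.Finite (A z) (T k n)) :
    (∀ e j : ℕ, 2 ≤ j → j ≤ n →
      SitsInDegrees (HWPiece z (p ^ e) j)
        (Set.Icc (-((j : ℤ) - 1) * (p : ℤ) ^ e) (-((j : ℤ) - 2) * (p : ℤ) ^ e - 2))) ∧
    (∀ e : ℕ,
      SitsInDegrees (HWPiece z (p ^ e) (n + 1))
        (Set.Iic (-((n : ℤ) - 1) * (p : ℤ) ^ e - 2))) ∧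
    (∀ r : ℤ, 0 < r →
      (∀ j : ℕ, 2 ≤ j → j ≤ n + 1 →
        (∀ e : ℕ, Module.Finite k (HWPiece z (p ^ e) j (-((j : ℤ) - 2) * (p : ℤ) ^ e - r))) ∧
        (fun e : ℕ => (Module.finrank k
            (HWPiece z (p ^ e) j (-((j : ℤ) - 2) * (p : ℤ) ^ e - r)) : ℝ))
          =o[atTop] fun e : ℕ => ((p : ℝ) ^ e) ^ n) ∧
      (∀ t : ℕ,
        (∀ e : ℕ, Module.Finite k
          (HWPiece z (p ^ e) (n + 1) (-((n : ℤ) + t) * (p : ℤ) ^ e - r))) ∧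
        (fun e : ℕ => (Module.finrank k
            (HWPiece z (p ^ e) (n + 1) (-((n : ℤ) + t) * (p : ℤ) ^ e - r)) : ℝ))
          =o[atTop] fun e : ℕ => ((p : ℝ) ^ e) ^ (n + 1))) ∧
    (∀ r : ℤ, 0 < r → ∀ j : ℕ, j ≤ n →
      (∀ e : ℕ, Module.Finite k (modPiece (HWPiece z (p ^ e) j) (-r) ((p : ℤ) ^ e))) ∧
      (fun e : ℕ => (Module.finrank k
          (modPiece (HWPiece z (p ^ e) j) (-r) ((p : ℤ) ^ e)) : ℝ))
        =o[atTop] fun e : ℕ => ((p : ℝ) ^ e) ^ n) := by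
  exact degrees_and_growth_of_HPiece (k := k) (A := A z) (M := fun q => W k n q) (z := gens z)
    (ℳ := fun q => WPiece k n q) (Fact.out : p.Prime).one_lt hn
    (fun q d => rank_HWPiece_zero hz q hn hfin d)
    (fun q d => rank_HWPiece_one hz q hn hfin d)
    (fun q l d _ => rank_HWPiece_le hz q hn hfin l d)
    (fun q j => iSup_HWPiece hz q hn hfin j)
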